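/- **Theorem (ACDM on SPD systems).** *Setting.* Let $n\ge 1$, let $A\in\mathbb R^{n\times n}$ be symmetric positive definite with eigenvalues $0<\lambda_1\le\dots\le\lambda_n$, let $m$ be the number of nonzero entries of $A$ and $\mathrm{nnz}_i$ that of its $i$-th row, and let $r(A)=\sum_{i}\lambda_i/\lambda_n$ be its numerical rank. Let $b\in\mathbb R^n$, $f(x)=\frac12\langle Ax,x\rangle-\langle b,x\rangle$, let $x^*$ be the solution of $Ax=b$, and write $\|x\|_A=\sqrt{x^TAx}$. *The method.* Let $f_i=e_i^T\nabla f$, let $L_i$ be the least constant with $|f_i(x+te_i)-f_i(x)|\le L_i|t|$ for all $x\in\mathbb R^n$, $t\in\mathbb R$, and let $\sigma$ be the largest number with $f(y)\ge f(x)+\langle\nabla f(x),y-x\rangle+\frac{\sigma}{2}\|y-x\|_2^2$ for all $x,y$. Put $S=\sum_i L_i$, $\tilde L_i=\max(L_i,S/n)$ and $\tilde S=\sum_i\tilde L_i$. The accelerated coordinate descent method (ACDM) with $\alpha=1$, started at $x_0\in\mathbb R^n$, sets $v_0=x_0$, $a_0=\frac1{2n}$, $b_0=2$, and for $k=0,1,2,\dots$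 1. takes $\alpha_k,\beta_k$ and $\gamma_k\ge\frac1{2n}$ with $$\gamma_k^2-\frac{\gamma_k}{2n}=\Bigl(1-\frac{\gamma_k\sigma}{\tilde S}\Bigr)\frac{a_k^2}{b_k^2}=\beta_k\frac{a_k^2}{b_k^2}=\frac{\beta_k\gamma_k}{2n}\cdot\frac{1-\alpha_k}{\alpha_k};$$ 2. sets $y_k=\alpha_kv_k+(1-\alpha_k)x_k$; 3. picks $i_k\in\{1,\dots,n\}$ at random, independently of the earlier choices, with $\Pr[i_k=i]=\tilde L_i/\tilde S$; 4. sets $x_{k+1}=y_k-\frac1{\tilde L_{i_k}}f_{i_k}(y_k)e_{i_k}$ and $v_{k+1}=\beta_kv_k+(1-\beta_k)y_k-\frac{\gamma_k}{\tilde L_{i_k}}f_{i_k}(y_k)e_{i_k}$; 5. sets $b_{k+1}=b_k/\sqrt{\beta_k}$ and $a_{k+1}=\gamma_kb_{k+1}$. *Model of computation.* A randomized unit-cost random access machine: arithmetic operations, square roots and comparisons of real numbers, memory accesses, the draw of a uniform random number in $[0,1]$, and addition, subtraction, halving and comparison of indices cost one unit each. *Claim.* There are one program and one exponent $p$, and for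 every $c$ a constant $C$ that depends on $c$ only, such that the following holds for all $n$, $A$, $b$, $x_0$ as above with $\mathrm{nnz}_i\le c\,\frac mn$ for all $i$, and for all $\varepsilon\in(0,\frac12]$. Given $n$, a compressed sparse row representation of $A$, the vectors $b$ and $x_0$, the convexity parameter $\sigma$ and $\varepsilon$, the program always halts after at most $$C\,m\,\sqrt{\frac{r(A)}{n}}\,\sqrt{\frac{\lambda_n}{\lambda_1}}\,\log\frac1\varepsilon\cdot(1+\log n)^p$$ units of time, and its output is the iterate $x_K$ of ACDM with $\alpha=1$ for some $K$ that does not depend on the random choices, where $$\mathbb E\,\|x_K-x^*\|_A\le\varepsilon\,\|x_0-x^*\|_A .$$ -/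

import Mathlib

/-! ### A randomized unit-cost RAM

A program is a fixed finite piece of syntax over finitely many named arrays. An array of natural
numbers (indices) or of real numbers is addressed by a literal name and a computed index. Every
primitive operation, every memory access, every test and every uniform random draw costs one
unit. Indices can only be added, subtracted and halved, and there is no operation that turns a
real number into an index (no floor). -/

namespace RAM

/-- Contents of the memory, and the number of random draws made so far.
`nat a i` and `real a i` are the cells with index `i` of the arrays with name `a`. -/
@[ext] structure State where
  nat : ℕ → ℕ → ℕ
  real : ℕ → ℕ → ℝ
  draws : ℕ

/-- Index expressions; `sub` is truncated subtraction and `half` is the right shift. -/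
inductive NatExp where
  | const (c : ℕ)
  | get (a : ℕ) (i : NatExp)
  | add (e₁ e₂ : NatExp)
  | sub (e₁ e₂ : NatExp)
  | half (e : NatExp)

/-- Real expressions; literals are rational. -/
inductive RealExp where
  | const (q : ℚ)
  | ofNat (e : NatExp)
  | get (a : ℕ) (i : NatExp)
  | add (e₁ e₂ : RealExp)
  | sub (e₁ e₂ : RealExp)
  | mul (e₁ e₂ : RealExp)
  | div (e₁ e₂ : RealExp)
  | sqrt (e : RealExp)

/-- Comparisons. -/
inductive Test where
  | natLt (e₁ e₂ : NatExp)
  | realLt (e₁ e₂ : RealExp)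

/-- Programs. `setNat a i e` and `setReal a i e` store the value of `e` in cell `i` of array `a`;
`rand a i` stores there a fresh uniform random number of `[0, 1]`. -/
inductive Cmd where
  | skip
  | setNat (a : ℕ) (i e : NatExp)
  | setReal (a : ℕ) (i : NatExp) (e : RealExp)
  | rand (a : ℕ) (i : NatExp)
  | seq (c₁ c₂ : Cmd)
  | ite (t : Test) (c₁ c₂ : Cmd)
  | loop (t : Test) (c : Cmd)

def NatExp.eval (s : State) : NatExp → ℕ
  | .const c => c
  | .get a i => s.nat a (i.eval s)
  | .add e₁ e₂ => e₁.eval s + e₂.eval s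
  | .sub e₁ e₂ => e₁.eval s - e₂.eval s
  | .half e => e.eval s / 2

def NatExp.cost : NatExp → ℕ
  | .const _ => 1
  | .get _ i => i.cost + 1
  | .add e₁ e₂ => e₁.cost + e₂.cost + 1
  | .sub e₁ e₂ => e₁.cost + e₂.cost + 1
  | .half e => e.cost + 1

/-- Division by zero and square roots of negative numbers give `0`; a program could test for
these cases at unit cost, so that this adds no power. -/
noncomputable def RealExp.eval (s : State) : RealExp → ℝ
  | .const q => q
  | .ofNat e => e.eval s
  | .get a i => s.real a (i.eval s)
  | .add e₁ e₂ => e₁.eval s + e₂.eval s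
  | .sub e₁ e₂ => e₁.eval s - e₂.eval s
  | .mul e₁ e₂ => e₁.eval s * e₂.eval s
  | .div e₁ e₂ => e₁.eval s / e₂.eval s
  | .sqrt e => Real.sqrt (e.eval s)

def RealExp.cost : RealExp → ℕ
  | .const _ => 1
  | .ofNat e => e.cost + 1
  | .get _ i => i.cost + 1
  | .add e₁ e₂ => e₁.cost + e₂.cost + 1
  | .sub e₁ e₂ => e₁.cost + e₂.cost + 1
  | .mul e₁ e₂ => e₁.cost + e₂.cost + 1
  | .div e₁ e₂ => e₁.cost + e₂.cost + 1
  | .sqrt e => e.cost + 1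

def Test.Holds (s : State) : Test → Prop
  | .natLt e₁ e₂ => e₁.eval s < e₂.eval s
  | .realLt e₁ e₂ => e₁.eval s < e₂.eval s

def Test.cost : Test → ℕ
  | .natLt e₁ e₂ => e₁.cost + e₂.cost + 1
  | .realLt e₁ e₂ => e₁.cost + e₂.cost + 1

def State.setNat (s : State) (a i v : ℕ) : State :=
  { s with nat := Function.update s.nat a (Function.update (s.nat a) i v) }

def State.setReal (s : State) (a i : ℕ) (v : ℝ) : State :=
  { s with real := Function.update s.real a (Function.update (s.real a) i v) }

/-- The sequence of random numbers that a run has at its disposal. -/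
abbrev Coins : Type := ℕ → unitInterval

/-- Independent, uniformly distributed random numbers in `[0, 1]`. -/
noncomputable def coinMeasure : MeasureTheory.Measure Coins :=
  MeasureTheory.Measure.infinitePi fun _ : ℕ =>
    (MeasureTheory.volume : MeasureTheory.Measure unitInterval)

/-- `Exec ω c s s' t`: started in `s` with random numbers `ω`, the program `c` halts in `s'` after
exactly `t` units of time. -/
inductive Exec (ω : Coins) : Cmd → State → State → ℕ → Prop where
  | skip (s : State) : Exec ω .skip s s 1
  | setNat (s : State) (a : ℕ) (i e : NatExp) :
      Exec ω (.setNat a i e) s (s.setNat a (i.eval s) (e.eval s)) (i.cost + e.cost + 1)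
  | setReal (s : State) (a : ℕ) (i : NatExp) (e : RealExp) :
      Exec ω (.setReal a i e) s (s.setReal a (i.eval s) (e.eval s)) (i.cost + e.cost + 1)
  | rand (s : State) (a : ℕ) (i : NatExp) :
      Exec ω (.rand a i) s
        { s.setReal a (i.eval s) (ω s.draws) with draws := s.draws + 1 } (i.cost + 1)
  | seq {c₁ c₂ : Cmd} {s s₁ s₂ : State} {t₁ t₂ : ℕ} (h₁ : Exec ω c₁ s s₁ t₁)
      (h₂ : Exec ω c₂ s₁ s₂ t₂) : Exec ω (.seq c₁ c₂) s s₂ (t₁ + t₂)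
  | ite_true {b : Test} {c₁ c₂ : Cmd} {s s' : State} {t : ℕ} (hb : b.Holds s)
      (h : Exec ω c₁ s s' t) : Exec ω (.ite b c₁ c₂) s s' (b.cost + t)
  | ite_false {b : Test} {c₁ c₂ : Cmd} {s s' : State} {t : ℕ} (hb : ¬ b.Holds s)
      (h : Exec ω c₂ s s' t) : Exec ω (.ite b c₁ c₂) s s' (b.cost + t)
  | loop_true {b : Test} {c : Cmd} {s s₁ s₂ : State} {t₁ t₂ : ℕ} (hb : b.Holds s)
      (h₁ : Exec ω c s s₁ t₁) (h₂ : Exec ω (.loop b c) s₁ s₂ t₂) :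
      Exec ω (.loop b c) s s₂ (b.cost + t₁ + t₂)
  | loop_false {b : Test} {c : Cmd} {s : State} (hb : ¬ b.Holds s) :
      Exec ω (.loop b c) s s b.cost

/-- Final state and running time are determined by the start state and the random numbers. -/
theorem Exec.deterministic {ω : Coins} {c : Cmd} {s s₁ s₂ : State} {t₁ t₂ : ℕ}
    (h₁ : Exec ω c s s₁ t₁) (h₂ : Exec ω c s s₂ t₂) : s₁ = s₂ ∧ t₁ = t₂ := by
  induction h₁ generalizing s₂ t₂ with
  | skip | setNat | setReal | rand => cases h₂; exact ⟨rfl, rfl⟩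
  | seq _ _ ih₁ ih₂ =>
    cases h₂ with
    | seq g₁ g₂ =>
      obtain ⟨rfl, rfl⟩ := ih₁ g₁
      obtain ⟨rfl, rfl⟩ := ih₂ g₂
      exact ⟨rfl, rfl⟩
  | ite_true hb _ ih =>
    cases h₂ with
    | ite_true _ g => obtain ⟨rfl, rfl⟩ := ih g; exact ⟨rfl, rfl⟩
    | ite_false hb' _ => exact absurd hb hb'
  | ite_false hb _ ih =>
    cases h₂ with
    | ite_true hb' _ => exact absurd hb' hb
    | ite_false _ g => obtain ⟨rfl, rfl⟩ := ih g; exact ⟨rfl, rfl⟩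
  | loop_true hb _ _ ih₁ ih₂ =>
    cases h₂ with
    | loop_true _ g₁ g₂ =>
      obtain ⟨rfl, rfl⟩ := ih₁ g₁
      obtain ⟨rfl, rfl⟩ := ih₂ g₂
      exact ⟨rfl, rfl⟩
    | loop_false hb' => exact absurd hb hb'
  | loop_false hb =>
    cases h₂ with
    | loop_true hb' _ _ => exact absurd hb' hb
    | loop_false _ => exact ⟨rfl, rfl⟩

end RAM

/-! ### The accelerated coordinate descent method -/

namespace ACDM

variable {n : ℕ}

/-- The partial derivative `f_i(x) = e_iᵀ ∇f(x)`. -/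
noncomputable def partialDeriv (f : (Fin n → ℝ) → ℝ) (i : Fin n) (x : Fin n → ℝ) : ℝ :=
  fderiv ℝ f x (Pi.single i 1)

/-- The component-wise Lipschitz constant `L_i` of the gradient (the best one). -/
noncomputable def lipschitz (f : (Fin n → ℝ) → ℝ) (i : Fin n) : ℝ :=
  sInf {M : ℝ | 0 ≤ M ∧ ∀ (x : Fin n → ℝ) (t : ℝ),
    |partialDeriv f i (x + t • Pi.single i 1) - partialDeriv f i x| ≤ M * |t|}

/-- `S_α = ∑ L_i ^ α`. -/
noncomputable def totalLipschitz (f : (Fin n → ℝ) → ℝ) (α : ℝ) : ℝ :=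
  ∑ i, lipschitz f i ^ α

/-- The norm `‖x‖_{1-α} = √(∑ L_i ^ (1-α) x_i²)`; it is the Euclidean norm for `α = 1`. -/
noncomputable def coordNorm (f : (Fin n → ℝ) → ℝ) (α : ℝ) (x : Fin n → ℝ) : ℝ :=
  Real.sqrt (∑ i, lipschitz f i ^ (1 - α) * x i ^ 2)

/-- The convexity parameter `σ_{1-α}` of `f` with respect to `‖·‖_{1-α}` (the best one). -/
noncomputable def convexityParam (f : (Fin n → ℝ) → ℝ) (α : ℝ) : ℝ :=
  sSup {σ : ℝ | ∀ x y : Fin n → ℝ,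
    f x + ∑ i, partialDeriv f i x * (y i - x i) + σ / 2 * coordNorm f α (y - x) ^ 2 ≤ f y}

/-- `L̃_i = max (L_i, (S_α / n)^(1/α))`. -/
noncomputable def modLipschitz (f : (Fin n → ℝ) → ℝ) (α : ℝ) (i : Fin n) : ℝ :=
  max (lipschitz f i) ((totalLipschitz f α / n) ^ (1 / α))

/-- `S̃_α = ∑ L̃_i ^ α`. -/
noncomputable def modTotal (f : (Fin n → ℝ) → ℝ) (α : ℝ) : ℝ :=
  ∑ i, modLipschitz f α i ^ α

/-- The probability with which the method picks the coordinate `i`. -/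
noncomputable def sampleProb (f : (Fin n → ℝ) → ℝ) (α : ℝ) (i : Fin n) : ℝ :=
  modLipschitz f α i ^ α / modTotal f α

/-- All quantities that occur in a run: the coefficients `a_k, b_k, α_k, β_k, γ_k` and the
points `v_k, x_k, y_k`. -/
structure Trace (n : ℕ) where
  a : ℕ → ℝ
  b : ℕ → ℝ
  al : ℕ → ℝ
  be : ℕ → ℝ
  ga : ℕ → ℝ
  v : ℕ → Fin n → ℝ
  x : ℕ → Fin n → ℝ
  y : ℕ → Fin n → ℝ

/-- `T` is the run of the accelerated coordinate descent method on `f` with parameter `α`, started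
at `x₀`, in which the coordinate picked in iteration `k` is `idx k`. -/
structure IsRun (f : (Fin n → ℝ) → ℝ) (α : ℝ) (x₀ : Fin n → ℝ) (idx : ℕ → Fin n)
    (T : Trace n) : Prop where
  x_zero : T.x 0 = x₀
  v_zero : T.v 0 = x₀
  a_zero : T.a 0 = 1 / (2 * n)
  b_zero : T.b 0 = 2
  ga_ge : ∀ k, 1 / (2 * n) ≤ T.ga k
  ga_eq : ∀ k, T.ga k ^ 2 - T.ga k / (2 * n) =
    (1 - T.ga k * convexityParam f α / modTotal f α) * (T.a k ^ 2 / T.b k ^ 2)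
  be_eq : ∀ k, (1 - T.ga k * convexityParam f α / modTotal f α) * (T.a k ^ 2 / T.b k ^ 2) =
    T.be k * (T.a k ^ 2 / T.b k ^ 2)
  al_eq : ∀ k, T.be k * (T.a k ^ 2 / T.b k ^ 2) =
    T.be k * T.ga k / (2 * n) * ((1 - T.al k) / T.al k)
  y_eq : ∀ k, T.y k = T.al k • T.v k + (1 - T.al k) • T.x k
  x_succ : ∀ k, T.x (k + 1) = T.y k -
    (1 / modLipschitz f α (idx k) * partialDeriv f (idx k) (T.y k)) • Pi.single (idx k) 1
  v_succ : ∀ k, T.v (k + 1) = T.be k • T.v k + (1 - T.be k) • T.y k -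
    (T.ga k / modLipschitz f α (idx k) * partialDeriv f (idx k) (T.y k)) • Pi.single (idx k) 1
  b_succ : ∀ k, T.b (k + 1) = T.b k / Real.sqrt (T.be k)
  a_succ : ∀ k, T.a (k + 1) = T.ga k * T.b (k + 1)

end ACDM

/-! ### Sparse linear systems -/

namespace LinSys

variable {n : ℕ}

/-- The quadratic objective `f(x) = ½⟨Ax, x⟩ - ⟨b, x⟩`. -/
noncomputable def objective (A : Matrix (Fin n) (Fin n) ℝ) (b x : Fin n → ℝ) : ℝ :=
  1 / 2 * (A.mulVec x ⬝ᵥ x) - b ⬝ᵥ x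

/-- The norm `‖x‖_A = √(xᵀ A x)`. -/
noncomputable def energyNorm (A : Matrix (Fin n) (Fin n) ℝ) (x : Fin n → ℝ) : ℝ :=
  Real.sqrt (x ⬝ᵥ A.mulVec x)

/-- The number of nonzero entries. -/
noncomputable def nnz (A : Matrix (Fin n) (Fin n) ℝ) : ℕ :=
  {p : Fin n × Fin n | A p.1 p.2 ≠ 0}.ncard

/-- The number of nonzero entries of row `i`. -/
noncomputable def rowNnz (A : Matrix (Fin n) (Fin n) ℝ) (i : Fin n) : ℕ :=
  {j : Fin n | A i j ≠ 0}.ncard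

/-- The largest eigenvalue `λ_n`. -/
noncomputable def maxEig {A : Matrix (Fin n) (Fin n) ℝ} (hA : A.IsHermitian) : ℝ :=
  ⨆ i, hA.eigenvalues i

/-- The smallest eigenvalue `λ_1`. -/
noncomputable def minEig {A : Matrix (Fin n) (Fin n) ℝ} (hA : A.IsHermitian) : ℝ :=
  ⨅ i, hA.eigenvalues i

/-- The numerical rank `∑ λ_i / λ_n`. -/
noncomputable def numRank {A : Matrix (Fin n) (Fin n) ℝ} (hA : A.IsHermitian) : ℝ :=
  (∑ i, hA.eigenvalues i) / maxEig hA

/-- A compressed sparse row representation of `A`: the positions `ptr i, …, ptr (i+1) - 1` list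
the columns and the values of the nonzero entries of row `i`, each once and in any order. -/
structure SparseRep (A : Matrix (Fin n) (Fin n) ℝ) where
  ptr : ℕ → ℕ
  col : ℕ → Fin n
  val : ℕ → ℝ
  ptr_zero : ptr 0 = 0
  ptr_le : ∀ i : Fin n, ptr i ≤ ptr ((i : ℕ) + 1)
  bijOn_col : ∀ i : Fin n, Set.BijOn col (Set.Ico (ptr i) (ptr ((i : ℕ) + 1))) {j | A i j ≠ 0}
  val_eq : ∀ i : Fin n, ∀ k ∈ Set.Ico (ptr i) (ptr ((i : ℕ) + 1)), val k = A i (col k)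

/-- The finite vector `x`, continued by zeros. -/
def pad (x : Fin n → ℝ) (i : ℕ) : ℝ := if h : i < n then x ⟨i, h⟩ else 0

/-- The memory at the start. Index array `0` holds `n` in cell `0`, index arrays `1`, `2` and real
array `0` hold the sparse representation of `A`, real arrays `1` and `2` hold `b` and `x₀`, real
array `3` holds `σ` and `ε` in the cells `0` and `1`; all the rest is `0`. -/
def inputState {A : Matrix (Fin n) (Fin n) ℝ} (D : SparseRep A) (b x₀ : Fin n → ℝ) (σ ε : ℝ) :
    RAM.State where
  nat a i := if a = 0 ∧ i = 0 then n else if a = 1 then D.ptr i else if a = 2 then D.col i else 0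
  real a i := if a = 0 then D.val i else if a = 1 then pad b i else if a = 2 then pad x₀ i
    else if a = 3 ∧ i = 0 then σ else if a = 3 ∧ i = 1 then ε else 0
  draws := 0

/-- The state `s` shows the vector `x` in real array `4`. -/
def IsOutput (s : RAM.State) (x : Fin n → ℝ) : Prop := ∀ i : Fin n, s.real 4 i = x i

end LinSys

/-! For the quadratic objective `L_i = A i i`, so `S = tr A`. Put `κ = σ/S̃`, `c_k = a_k/b_k` and
`B_k = β_0 ⋯ β_{k-1}`. The recursion collapses to one scalar sequence: `γ_k = c_{k+1}`, `β_k = 1 - κ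
c_{k+1}`, `b_k = 2/√B_k` and `α_k = γ_k/(γ_k + 2n c_k²)`, where `γ_k` is the positive root of `γ² -
γ/(2n) = (1 - κγ) c_k²`.

Convergence: the potential `‖v_k - x*‖² + (4n c_k²/S̃)(f(x_k) - f(x*))` shrinks in conditional
expectation by the factor `β_k` (`sum_potential_le`). Flattening the constants to `L̃_i` gives `S̃ ≤
2n L̃_i`, so the decrease of `f` along any sampled coordinate pays for the quadratic term of the
`v`-step. Independence of the choices turns this into `E Φ_k ≤ B_k Φ_0`. Since `Φ_0` is at most
`3/(2σ)` times the squared initial error, the criterion `3 B_k ≤ 4nκε² c_k²` forces the mean squared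
error below `ε²` times the initial one, and nonnegativity of the variance passes to the mean error
(`integral_energyNorm_le`).

Number of iterations: the recursion has the fixed point `g` with `2nκg² = 1`. Below `g/2` the
sequence `c_k` grows by at least `1/(8n)` per step, so it exceeds `g/2` after `4ng` steps, and from
then on `B_k` decays at least like `exp(-κgk/2)`. Because `1/(κg) = 2ng`, the criterion holds after
`O(ng log(1/ε))` steps. With `S̃ ≤ 2 tr A` and `λ_1 ≤ σ` one gets `g² ≤ tr A/(n λ_1) =
(r(A)/n)(λ_n/λ_1)` (`exists_iteration_count`).

Cost of an iteration: the vectors are never touched in full. The program stores `x = q + ηp` and `v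
- x = δp`; the dense operations only change the scalars `η` and `δ`, and the coordinate step changes
one entry of `p` and one of `q`. A partial derivative costs one row, `O(c m/n)`, and a coordinate is
drawn by bisection in a table of partial sums, `O(log n)`. The stopping test uses only deterministic
scalars, so the number `K` of iterations does not depend on the coins. As `m ≥ n`, multiplying the
two bounds gives the claim with one factor `1 + log n`. -/

/-! ### Reasoning about programs -/

namespace RAM

/-- Started in `s`, the program `c` halts within `T` units of time in a state that satisfies `R`. -/
def Runs (ω : Coins) (c : Cmd) (s : State) (R : State → Prop) (T : ℕ) : Prop :=
  ∃ s' t, Exec ω c s s' t ∧ R s' ∧ t ≤ T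

variable {ω : Coins}

theorem Runs.mono {c : Cmd} {s : State} {R R' : State → Prop} {T T' : ℕ}
    (h : Runs ω c s R T) (hR : ∀ s', R s' → R' s') (hT : T ≤ T') : Runs ω c s R' T' := by
  obtain ⟨s', t, he, hr, ht⟩ := h
  exact ⟨s', t, he, hR _ hr, ht.trans hT⟩

theorem Runs.seq {c₁ c₂ : Cmd} {s : State} {R R' : State → Prop} {T₁ T₂ : ℕ}
    (h₁ : Runs ω c₁ s R T₁) (h₂ : ∀ s', R s' → Runs ω c₂ s' R' T₂) :
    Runs ω (.seq c₁ c₂) s R' (T₁ + T₂) := by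
  obtain ⟨s₁, t₁, he₁, hr₁, ht₁⟩ := h₁
  obtain ⟨s₂, t₂, he₂, hr₂, ht₂⟩ := h₂ s₁ hr₁
  exact ⟨s₂, t₁ + t₂, .seq he₁ he₂, hr₂, add_le_add ht₁ ht₂⟩

theorem Runs.skip {s : State} {R : State → Prop} (h : R s) : Runs ω .skip s R 1 :=
  ⟨s, 1, .skip s, h, le_rfl⟩

theorem Runs.setNat {s : State} {R : State → Prop} {a : ℕ} {i e : NatExp}
    (h : R (s.setNat a (i.eval s) (e.eval s))) :
    Runs ω (.setNat a i e) s R (i.cost + e.cost + 1) :=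
  ⟨_, _, .setNat s a i e, h, le_rfl⟩

theorem Runs.setReal {s : State} {R : State → Prop} {a : ℕ} {i : NatExp} {e : RealExp}
    (h : R (s.setReal a (i.eval s) (e.eval s))) :
    Runs ω (.setReal a i e) s R (i.cost + e.cost + 1) :=
  ⟨_, _, .setReal s a i e, h, le_rfl⟩

theorem Runs.rand {s : State} {R : State → Prop} {a : ℕ} {i : NatExp}
    (h : R { s.setReal a (i.eval s) (ω s.draws) with draws := s.draws + 1 }) :
    Runs ω (.rand a i) s R (i.cost + 1) :=
  ⟨_, _, .rand s a i, h, le_rfl⟩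

theorem Runs.ite {b : Test} {c₁ c₂ : Cmd} {s : State} {R : State → Prop} {T : ℕ}
    (h₁ : b.Holds s → Runs ω c₁ s R T) (h₂ : ¬ b.Holds s → Runs ω c₂ s R T) :
    Runs ω (.ite b c₁ c₂) s R (b.cost + T) := by
  by_cases hb : b.Holds s
  · obtain ⟨s', t, he, hr, ht⟩ := h₁ hb
    exact ⟨s', _, .ite_true hb he, hr, by omega⟩
  · obtain ⟨s', t, he, hr, ht⟩ := h₂ hb
    exact ⟨s', _, .ite_false hb he, hr, by omega⟩

/-- A loop with an invariant indexed by the number `k` of completed rounds, `k ≤ N`. -/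
theorem Runs.loop {b : Test} {c : Cmd} {s : State} {I : ℕ → State → Prop} {k N T : ℕ}
    (hk : k ≤ N) (hI : I k s) (hstep : ∀ k s, k < N → I k s → b.Holds s ∧ Runs ω c s (I (k + 1)) T)
    (hend : ∀ s, I N s → ¬ b.Holds s) :
    Runs ω (.loop b c) s (I N) ((N - k) * (b.cost + T) + b.cost) := by
  induction hm : N - k generalizing k s with
  | zero =>
    obtain rfl : k = N := by omega
    exact ⟨s, _, .loop_false (hend s hI), hI, by simp⟩
  | succ m ih =>
    obtain ⟨hb, s₁, t₁, he₁, hr₁, ht₁⟩ := hstep k s (by omega) hI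
    obtain ⟨s₂, t₂, he₂, hr₂, ht₂⟩ := ih (by omega) hr₁ (by omega)
    refine ⟨s₂, _, .loop_true hb he₁ he₂, hr₂, ?_⟩
    rw [add_mul]
    omega

/-- A loop with a measure that at least halves in every round and is positive while the loop
goes on. -/
theorem Runs.loop_half {b : Test} {c : Cmd} {s : State} {I : State → Prop} {T m : ℕ}
    (μ : State → ℕ) (hI : I s) (hm : μ s < 2 ^ m)
    (hstep : ∀ s, I s → b.Holds s → 0 < μ s ∧ Runs ω c s (fun s' => I s' ∧ μ s' ≤ μ s / 2) T) :
    Runs ω (.loop b c) s (fun s' => I s' ∧ ¬ b.Holds s') (m * (b.cost + T) + b.cost) := by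
  induction m generalizing s with
  | zero =>
    have hb : ¬ b.Holds s := fun hb => by
      have := (hstep s hI hb).1
      simp at hm
      omega
    exact ⟨s, _, .loop_false hb, ⟨hI, hb⟩, by simp⟩
  | succ m ih =>
    by_cases hb : b.Holds s
    · obtain ⟨-, s₁, t₁, he₁, ⟨hI₁, hμ⟩, ht₁⟩ := hstep s hI hb
      obtain ⟨s₂, t₂, he₂, hr₂, ht₂⟩ := ih hI₁ (by rw [pow_succ] at hm; omega)
      refine ⟨s₂, _, .loop_true hb he₁ he₂, hr₂, ?_⟩
      rw [add_mul]
      omega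
    · exact ⟨s, _, .loop_false hb, ⟨hI, hb⟩, by omega⟩

/-- The names of the index arrays that a program may change. -/
def Cmd.natWrites : Cmd → List ℕ
  | .skip | .setReal .. | .rand .. => []
  | .setNat a _ _ => [a]
  | .seq c₁ c₂ | .ite _ c₁ c₂ => c₁.natWrites ++ c₂.natWrites
  | .loop _ c => c.natWrites

/-- The names of the real arrays that a program may change. -/
def Cmd.realWrites : Cmd → List ℕ
  | .skip | .setNat .. => []
  | .setReal a _ _ | .rand a _ => [a]
  | .seq c₁ c₂ | .ite _ c₁ c₂ => c₁.realWrites ++ c₂.realWrites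
  | .loop _ c => c.realWrites

/-- Whether a program may draw random numbers. -/
def Cmd.draws : Cmd → Bool
  | .skip | .setNat .. | .setReal .. => false
  | .rand .. => true
  | .seq c₁ c₂ | .ite _ c₁ c₂ => c₁.draws || c₂.draws
  | .loop _ c => c.draws

/-- `s'` agrees with `s` on everything that `c` does not write. -/
structure Frame (c : Cmd) (s s' : State) : Prop where
  nat : ∀ a, a ∉ c.natWrites → s'.nat a = s.nat a
  real : ∀ a, a ∉ c.realWrites → s'.real a = s.real a
  draws : c.draws = false → s'.draws = s.draws

/-- This lets a specification speak only of what a fragment computes: preservation of everything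
else reduces to a decidable check on finite lists of array names. -/
theorem Exec.frame {c : Cmd} {s s' : State} {t : ℕ} (h : Exec ω c s s' t) : Frame c s s' := by
  induction h with
  | skip => exact ⟨fun _ _ => rfl, fun _ _ => rfl, fun _ => rfl⟩
  | setNat s a =>
    refine ⟨fun a' ha => ?_, fun _ _ => rfl, fun _ => rfl⟩
    simp only [Cmd.natWrites, List.mem_singleton] at ha
    simp [State.setNat, ha]
  | setReal s a =>
    refine ⟨fun _ _ => rfl, fun a' ha => ?_, fun _ => rfl⟩
    simp only [Cmd.realWrites, List.mem_singleton] at ha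
    simp [State.setReal, ha]
  | rand s a =>
    refine ⟨fun _ _ => rfl, fun a' ha => ?_, fun h => by simp [Cmd.draws] at h⟩
    simp only [Cmd.realWrites, List.mem_singleton] at ha
    simp [State.setReal, ha]
  | seq _ _ ih₁ ih₂ =>
    refine ⟨fun a ha => ?_, fun a ha => ?_, fun h => ?_⟩
    · simp only [Cmd.natWrites, List.mem_append, not_or] at ha
      rw [ih₂.nat a ha.2, ih₁.nat a ha.1]
    · simp only [Cmd.realWrites, List.mem_append, not_or] at ha
      rw [ih₂.real a ha.2, ih₁.real a ha.1]
    · simp only [Cmd.draws, Bool.or_eq_false_iff] at h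
      rw [ih₂.draws h.2, ih₁.draws h.1]
  | ite_true _ _ ih | ite_false _ _ ih =>
    refine ⟨fun a ha => ?_, fun a ha => ?_, fun h => ?_⟩
    · simp only [Cmd.natWrites, List.mem_append, not_or] at ha
      exact ih.nat a (by tauto)
    · simp only [Cmd.realWrites, List.mem_append, not_or] at ha
      exact ih.real a (by tauto)
    · simp only [Cmd.draws, Bool.or_eq_false_iff] at h
      exact ih.draws (by tauto)
  | loop_true _ _ _ ih₁ ih₂ =>
    refine ⟨fun a ha => ?_, fun a ha => ?_, fun h => ?_⟩
    · rw [ih₂.nat a ha, ih₁.nat a ha]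
    · rw [ih₂.real a ha, ih₁.real a ha]
    · rw [ih₂.draws h, ih₁.draws h]
  | loop_false => exact ⟨fun _ _ => rfl, fun _ _ => rfl, fun _ => rfl⟩

theorem Runs.frame {c : Cmd} {s : State} {R : State → Prop} {T : ℕ} (h : Runs ω c s R T) :
    Runs ω c s (fun s' => R s' ∧ Frame c s s') T := by
  obtain ⟨s', t, he, hr, ht⟩ := h
  exact ⟨s', t, he, ⟨hr, he.frame⟩, ht⟩

end RAM

/-! ### The quadratic objective -/

namespace LinSys

open Matrix

variable {n : ℕ} {A : Matrix (Fin n) (Fin n) ℝ} {b : Fin n → ℝ}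

theorem dotProduct_mulVec_symm (hA : A.IsHermitian) (x y : Fin n → ℝ) :
    x ⬝ᵥ A *ᵥ y = y ⬝ᵥ A *ᵥ x := by
  have hT : Aᵀ = A := by simpa [conjTranspose_eq_transpose_of_trivial] using hA.eq
  rw [dotProduct_mulVec, dotProduct_comm, ← mulVec_transpose, hT]

theorem objective_add (hA : A.IsHermitian) (x z : Fin n → ℝ) :
    objective A b (x + z) = objective A b x + (A *ᵥ x - b) ⬝ᵥ z + 1 / 2 * (z ⬝ᵥ A *ᵥ z) := by
  have h := dotProduct_mulVec_symm hA x z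
  simp only [objective, mulVec_add, add_dotProduct, dotProduct_add, sub_dotProduct,
    dotProduct_comm (A *ᵥ _)]
  linarith

theorem differentiable_objective : Differentiable ℝ (objective A b) := by
  unfold objective mulVec dotProduct
  fun_prop

theorem partialDeriv_objective (hA : A.IsHermitian) (i : Fin n) (x : Fin n → ℝ) :
    ACDM.partialDeriv (objective A b) i x = (A *ᵥ x) i - b i := by
  rw [ACDM.partialDeriv, ← (differentiable_objective x).lineDeriv_eq_fderiv, lineDeriv]
  have h : (fun t : ℝ => objective A b (x + t • Pi.single i 1)) = fun t =>
      objective A b x + t * ((A *ᵥ x) i - b i) + t ^ 2 * (1 / 2 * A i i) := by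
    funext t
    rw [objective_add hA]
    simp [mulVec_smul, dotProduct_smul, smul_dotProduct]
    ring
  rw [h]
  have h₁ : HasDerivAt (fun t : ℝ => objective A b x + t * ((A *ᵥ x) i - b i) +
      t ^ 2 * (1 / 2 * A i i)) (1 * ((A *ᵥ x) i - b i) +
        (((2 : ℕ) : ℝ) * 0 ^ (2 - 1) * 1) * (1 / 2 * A i i)) 0 :=
    (((hasDerivAt_id (0 : ℝ)).mul_const _).const_add _).add
      (((hasDerivAt_id (0 : ℝ)).pow 2).mul_const _)
  rw [h₁.deriv]
  simp

/-! ### The coordinate constants and their sum. -/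

theorem diag_pos (hA : A.PosDef) (i : Fin n) : 0 < A i i := hA.diag_pos

theorem dotProduct_mulVec_nonneg (hA : A.PosDef) (z : Fin n → ℝ) : 0 ≤ z ⬝ᵥ A *ᵥ z := by
  simpa using hA.posSemidef.dotProduct_mulVec_nonneg z

/-- Along `e_i` the partial derivative changes by exactly `t * A i i`, so the infimum is attained.
-/
theorem lipschitz_objective (hA : A.PosDef) (i : Fin n) :
    ACDM.lipschitz (objective A b) i = A i i := by
  have h (x : Fin n → ℝ) (t : ℝ) : |ACDM.partialDeriv (objective A b) i (x + t • Pi.single i 1) -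
      ACDM.partialDeriv (objective A b) i x| = A i i * |t| := by
    rw [partialDeriv_objective hA.isHermitian, partialDeriv_objective hA.isHermitian]
    simp only [mulVec_add, mulVec_smul, Pi.add_apply, Pi.smul_apply, mulVec_single_one, col_apply,
      smul_eq_mul]
    rw [show (A *ᵥ x) i + t * A i i - b i - ((A *ᵥ x) i - b i) = A i i * t by ring, abs_mul,
      abs_of_pos (diag_pos hA i)]
  unfold ACDM.lipschitz
  simp only [h]
  refine IsLeast.csInf_eq ⟨⟨(diag_pos hA i).le, fun _ _ => le_rfl⟩, fun M hM => ?_⟩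
  simpa using hM.2 0 1

theorem totalLipschitz_objective (hA : A.PosDef) :
    ACDM.totalLipschitz (objective A b) 1 = A.trace := by
  simp [ACDM.totalLipschitz, lipschitz_objective hA, trace]

/-- The modified coordinate constants `max (A i i) (tr A / n)`. -/
noncomputable def modDiag (A : Matrix (Fin n) (Fin n) ℝ) (i : Fin n) : ℝ :=
  max (A i i) (A.trace / n)

/-- The sum of the modified coordinate constants. -/
noncomputable def modTrace (A : Matrix (Fin n) (Fin n) ℝ) : ℝ := ∑ i, modDiag A i

theorem modLipschitz_objective (hA : A.PosDef) (i : Fin n) :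
    ACDM.modLipschitz (objective A b) 1 i = modDiag A i := by
  simp [ACDM.modLipschitz, lipschitz_objective hA, totalLipschitz_objective hA, modDiag]

theorem modTotal_objective (hA : A.PosDef) :
    ACDM.modTotal (objective A b) 1 = modTrace A := by
  simp [ACDM.modTotal, modLipschitz_objective hA, modTrace]

theorem sampleProb_objective (hA : A.PosDef) (i : Fin n) :
    ACDM.sampleProb (objective A b) 1 i = modDiag A i / modTrace A := by
  simp [ACDM.sampleProb, modLipschitz_objective hA, modTotal_objective hA]

theorem modDiag_pos (hA : A.PosDef) (i : Fin n) : 0 < modDiag A i :=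
  lt_max_of_lt_left (diag_pos hA i)

theorem diag_le_modDiag (i : Fin n) : A i i ≤ modDiag A i := le_max_left _ _

theorem trace_pos (hA : A.PosDef) (hn : 0 < n) : 0 < A.trace := by
  have : NeZero n := ⟨hn.ne'⟩
  exact Finset.sum_pos (fun i _ => diag_pos hA i) Finset.univ_nonempty

theorem trace_le_modTrace : A.trace ≤ modTrace A :=
  Finset.sum_le_sum fun i _ => diag_le_modDiag i

theorem modTrace_pos (hA : A.PosDef) (hn : 0 < n) : 0 < modTrace A :=
  (trace_pos hA hn).trans_le trace_le_modTrace

/-- The maximum of two nonnegative numbers is at most their sum, and the added means sum to one more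
trace. -/
theorem modTrace_le (hA : A.PosDef) (hn : 0 < n) : modTrace A ≤ 2 * A.trace := by
  have h : ∀ i, modDiag A i ≤ A i i + A.trace / n := fun i =>
    max_le_add_of_nonneg (diag_pos hA i).le (div_nonneg (trace_pos hA hn).le (Nat.cast_nonneg _))
  calc modTrace A ≤ ∑ i, (A i i + A.trace / n) := Finset.sum_le_sum fun i _ => h i
    _ = A.trace + n * (A.trace / n) := by
      simp [Finset.sum_add_distrib, trace]
    _ = 2 * A.trace := by
      have : (n : ℝ) ≠ 0 := by positivity
      field_simp; ring

/-- This is what the flattening is for: no coordinate has a constant much smaller than the average,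
whatever the diagonal of `A` looks like. -/
theorem modTrace_le_modDiag (hA : A.PosDef) (hn : 0 < n) (i : Fin n) :
    modTrace A ≤ 2 * n * modDiag A i := by
  have h : A.trace / n ≤ modDiag A i := le_max_right _ _
  have hn' : (0 : ℝ) < n := by exact_mod_cast hn
  rw [div_le_iff₀ hn'] at h
  linarith [modTrace_le hA hn]

/-! ### The convexity parameter and the spectrum. -/

theorem coordNorm_sq (f : (Fin n → ℝ) → ℝ) (z : Fin n → ℝ) :
    ACDM.coordNorm f 1 z ^ 2 = z ⬝ᵥ z := by
  rw [ACDM.coordNorm, Real.sq_sqrt (Finset.sum_nonneg fun i _ => by simp [sq_nonneg])]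
  simp [dotProduct, sq]

theorem convexityParam_objective (hA : A.IsHermitian) :
    ACDM.convexityParam (objective A b) 1 =
      sSup {σ : ℝ | ∀ z : Fin n → ℝ, σ * (z ⬝ᵥ z) ≤ z ⬝ᵥ A *ᵥ z} := by
  unfold ACDM.convexityParam
  congr 1
  ext σ
  have key (x z : Fin n → ℝ) : objective A b x + ∑ i, ACDM.partialDeriv (objective A b) i x * z i +
      σ / 2 * ACDM.coordNorm (objective A b) 1 z ^ 2 ≤ objective A b (x + z) ↔
      σ * (z ⬝ᵥ z) ≤ z ⬝ᵥ A *ᵥ z := by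
    rw [objective_add hA, coordNorm_sq]
    simp only [partialDeriv_objective hA]
    change objective A b x + (A *ᵥ x - b) ⬝ᵥ z + _ ≤ _ ↔ _
    constructor <;> intro h <;> linarith
  constructor
  · intro h z
    exact (key 0 z).1 (by simpa using h 0 z)
  · intro h x y
    simpa using (key x (y - x)).2 (h _)

theorem bddAbove_convexity (hn : 0 < n) :
    BddAbove {σ : ℝ | ∀ z : Fin n → ℝ, σ * (z ⬝ᵥ z) ≤ z ⬝ᵥ A *ᵥ z} :=
  ⟨A ⟨0, hn⟩ ⟨0, hn⟩, fun σ h => by simpa using h (Pi.single ⟨0, hn⟩ 1)⟩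

/-- In an eigenbasis `A - λ_1 I` is diagonal with the nonnegative entries `λ_i - λ_1`. -/
theorem minEig_mul_le (hA : A.IsHermitian) (z : Fin n → ℝ) :
    minEig hA * (z ⬝ᵥ z) ≤ z ⬝ᵥ A *ᵥ z := by
  have hpsd : (A - minEig hA • (1 : Matrix (Fin n) (Fin n) ℝ)).PosSemidef := by
    have hD : (diagonal fun i => hA.eigenvalues i - minEig hA).PosSemidef :=
      PosSemidef.diagonal fun i =>
        sub_nonneg.2 (ciInf_le (Set.finite_range hA.eigenvalues).bddBelow i)
    have hU := hD.mul_mul_conjTranspose_same (hA.eigenvectorUnitary : Matrix (Fin n) (Fin n) ℝ)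
    convert hU using 1
    have hUU : (hA.eigenvectorUnitary : Matrix (Fin n) (Fin n) ℝ) *
        (hA.eigenvectorUnitary : Matrix (Fin n) (Fin n) ℝ)ᴴ = 1 :=
      Unitary.mul_star_self_of_mem hA.eigenvectorUnitary.2
    have hs : (diagonal fun i => hA.eigenvalues i - minEig hA) =
        diagonal hA.eigenvalues - minEig hA • (1 : Matrix (Fin n) (Fin n) ℝ) := by
      rw [smul_one_eq_diagonal, diagonal_sub]
    rw [hs, mul_sub, sub_mul, mul_smul_comm, smul_mul_assoc, mul_one, hUU]
    congr 1
    conv_lhs => rw [hA.spectral_theorem]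
    rfl
  have h := hpsd.dotProduct_mulVec_nonneg z
  simp only [star_trivial, sub_mulVec, smul_mulVec, one_mulVec, dotProduct_sub, dotProduct_smul,
    smul_eq_mul] at h
  linarith

theorem minEig_le_convexityParam (hA : A.IsHermitian) (hn : 0 < n) :
    minEig hA ≤ ACDM.convexityParam (objective A b) 1 := by
  rw [convexityParam_objective hA]
  exact le_csSup (bddAbove_convexity hn) (minEig_mul_le hA)

/-- The supremum is itself admissible: for fixed `z ≠ 0` the condition is an upper bound on `σ`,
which survives passing to the supremum. -/
theorem convexityParam_mul_le (hA : A.IsHermitian) (z : Fin n → ℝ) :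
    ACDM.convexityParam (objective A b) 1 * (z ⬝ᵥ z) ≤ z ⬝ᵥ A *ᵥ z := by
  rw [convexityParam_objective hA]
  rcases eq_or_ne z 0 with rfl | hz
  · simp
  · have hz' : 0 < z ⬝ᵥ z := lt_of_le_of_ne (Finset.sum_nonneg fun i _ => mul_self_nonneg _)
      (Ne.symm (by simpa [dotProduct_self_eq_zero] using hz))
    rw [← le_div_iff₀ hz']
    exact csSup_le ⟨_, minEig_mul_le hA⟩ fun σ h => (le_div_iff₀ hz').2 (h z)

theorem minEig_pos (hA : A.PosDef) (hn : 0 < n) : 0 < minEig hA.isHermitian := by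
  have : NeZero n := ⟨hn.ne'⟩
  obtain ⟨i, hi⟩ := exists_eq_ciInf_of_finite (f := hA.isHermitian.eigenvalues)
  rw [minEig, ← hi]
  exact hA.eigenvalues_pos i

theorem maxEig_pos (hA : A.PosDef) (hn : 0 < n) : 0 < maxEig hA.isHermitian :=
  (hA.eigenvalues_pos ⟨0, hn⟩).trans_le
    (le_ciSup (Set.finite_range hA.isHermitian.eigenvalues).bddAbove _)

theorem convexityParam_pos (hA : A.PosDef) (hn : 0 < n) :
    0 < ACDM.convexityParam (objective A b) 1 :=
  (minEig_pos hA hn).trans_le (minEig_le_convexityParam hA.isHermitian hn)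

/-- Testing convexity on `e_i` gives `σ ≤ A i i`; sum over `i`. -/
theorem mul_convexityParam_le_trace (hA : A.IsHermitian) :
    n * ACDM.convexityParam (objective A b) 1 ≤ A.trace := by
  have h : ∀ i : Fin n, ACDM.convexityParam (objective A b) 1 ≤ A i i := fun i => by
    simpa using convexityParam_mul_le (b := b) hA (Pi.single i 1)
  calc n * ACDM.convexityParam (objective A b) 1
      = ∑ _i : Fin n, ACDM.convexityParam (objective A b) 1 := by simp
    _ ≤ A.trace := Finset.sum_le_sum fun i _ => h i

theorem numRank_mul_maxEig (hA : A.PosDef) (hn : 0 < n) :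
    numRank hA.isHermitian * maxEig hA.isHermitian = A.trace := by
  rw [numRank, div_mul_cancel₀ _ (maxEig_pos hA hn).ne', hA.isHermitian.trace_eq_sum_eigenvalues]
  simp

theorem objective_sub_objective {xs : Fin n → ℝ} (hA : A.IsHermitian) (hxs : A *ᵥ xs = b)
    (x : Fin n → ℝ) :
    objective A b x - objective A b xs = 1 / 2 * ((x - xs) ⬝ᵥ A *ᵥ (x - xs)) := by
  have h := objective_add (b := b) hA xs (x - xs)
  rw [add_sub_cancel, hxs, sub_self, zero_dotProduct] at h
  linarith

end LinSys

/-! ### The coefficients of the method -/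

namespace ACDM

/-- The positive root `γ` of `γ² - γ / (2N) = (1 - κγ) c²`. -/
noncomputable def nextCoef (N κ c : ℝ) : ℝ :=
  (1 / (2 * N) - κ * c ^ 2 + √((1 / (2 * N) - κ * c ^ 2) ^ 2 + 4 * c ^ 2)) / 2

section NextCoef

variable {N κ c x : ℝ}

theorem nextCoef_sq :
    nextCoef N κ c ^ 2 = (1 / (2 * N) - κ * c ^ 2) * nextCoef N κ c + c ^ 2 := by
  have h := Real.sq_sqrt (show 0 ≤ (1 / (2 * N) - κ * c ^ 2) ^ 2 + 4 * c ^ 2 by positivity)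
  unfold nextCoef
  linear_combination h / 4

theorem nextCoef_pos (hc : 0 < c) : 0 < nextCoef N κ c := by
  have h : |1 / (2 * N) - κ * c ^ 2| < √((1 / (2 * N) - κ * c ^ 2) ^ 2 + 4 * c ^ 2) := by
    rw [← Real.sqrt_sq_eq_abs]
    exact Real.sqrt_lt_sqrt (sq_nonneg _) (by linarith [pow_pos hc 2])
  have := neg_abs_le (1 / (2 * N) - κ * c ^ 2)
  unfold nextCoef
  linarith

/-- The expression is minus the other root of the quadratic, and the product of the roots is `-c²`.
-/
theorem coef_sub_pos (hc : 0 < c) : 0 < nextCoef N κ c - (1 / (2 * N) - κ * c ^ 2) := by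
  have h := nextCoef_pos (N := N) (κ := κ) hc
  have : 0 < nextCoef N κ c * (nextCoef N κ c - (1 / (2 * N) - κ * c ^ 2)) := by
    rw [mul_sub, ← sq, nextCoef_sq]
    nlinarith [pow_pos hc 2]
  exact pos_of_mul_pos_right this h.le

/-- The quadratic factors as `(x - γ)(x + γ - s)` with `s = 1/(2N) - κc²`. The second factor is
positive for `x ≥ 0`, so the sign of the quadratic at a test point locates `γ`. This lemma and the
next give the later bounds by choosing suitable test points. -/
theorem le_nextCoef (hc : 0 < c) (hx : 0 ≤ x)
    (h : x ^ 2 ≤ (1 / (2 * N) - κ * c ^ 2) * x + c ^ 2) : x ≤ nextCoef N κ c := by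
  by_contra! hlt
  have := mul_pos (sub_pos.2 hlt) (add_pos_of_nonneg_of_pos hx (coef_sub_pos (N := N) (κ := κ) hc))
  nlinarith [nextCoef_sq (N := N) (κ := κ) (c := c)]

theorem nextCoef_le (hc : 0 < c) (hx : 0 ≤ x)
    (h : (1 / (2 * N) - κ * c ^ 2) * x + c ^ 2 ≤ x ^ 2) : nextCoef N κ c ≤ x := by
  by_contra! hlt
  have := mul_pos (sub_pos.2 hlt) (add_pos_of_nonneg_of_pos hx (coef_sub_pos (N := N) (κ := κ) hc))
  nlinarith [nextCoef_sq (N := N) (κ := κ) (c := c)]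

theorem nextCoef_eq :
    nextCoef N κ c ^ 2 - nextCoef N κ c / (2 * N) = (1 - nextCoef N κ c * κ) * c ^ 2 := by
  rw [nextCoef_sq]
  ring

theorem nextCoef_ge (hN : 1 ≤ N) (hκ' : κ ≤ 1) (hc : 0 < c) :
    1 / (2 * N) ≤ nextCoef N κ c := by
  refine le_nextCoef hc (by positivity) ?_
  have h₁ : 1 / (2 * N) ≤ 1 := by rw [div_le_one (by positivity)]; linarith
  have h₂ : κ * (1 / (2 * N)) ≤ 1 := mul_le_one₀ hκ' (by positivity) h₁
  nlinarith [mul_le_mul_of_nonneg_left h₂ (sq_nonneg c)]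

/-- Were `κγ ≥ 1`, the right side of the defining equation would be nonpositive, forcing `γ ≤ 1/(2N)
< 1` and hence `κγ < 1`. -/
theorem nextCoef_mul_lt_one (hN : 1 ≤ N) (hκ : 0 < κ) (hκ' : κ ≤ 1) (hc : 0 < c) :
    nextCoef N κ c * κ < 1 := by
  by_contra! h
  have hpos := nextCoef_pos (N := N) (κ := κ) hc
  have h₁ : 1 / (2 * N) < 1 := by rw [div_lt_one (by positivity)]; linarith
  have h₂ : nextCoef N κ c * (nextCoef N κ c - 1 / (2 * N)) ≤ 0 := by
    have := nextCoef_eq (N := N) (κ := κ) (c := c)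
    rw [show nextCoef N κ c * (nextCoef N κ c - 1 / (2 * N)) =
      nextCoef N κ c ^ 2 - nextCoef N κ c / (2 * N) by ring, this]
    exact mul_nonpos_of_nonpos_of_nonneg (by linarith) (sq_nonneg c)
  have h₃ : nextCoef N κ c - 1 / (2 * N) ≤ 0 := nonpos_of_mul_nonpos_right h₂ hpos
  nlinarith

theorem self_le_nextCoef (hN : 1 ≤ N) (hc : 0 < c) (h : 2 * N * κ * c ^ 2 ≤ 1) :
    c ≤ nextCoef N κ c := by
  refine le_nextCoef hc hc.le ?_
  have : κ * c ^ 2 ≤ 1 / (2 * N) := by rw [le_div_iff₀ (by positivity)]; linarith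
  nlinarith [mul_nonneg (sub_nonneg.2 this) hc.le]

/-- At the fixed point `g` the test inequality reads `κg (g² - c²) ≤ g² - c²`, so it only needs `κg
≤ 1` and `c ≤ g`. -/
theorem nextCoef_le_fixed {g : ℝ} (hN : 1 ≤ N) (hκ' : κ ≤ 1) (hg : 0 < g)
    (hgg : 2 * N * κ * g ^ 2 = 1) (hc : 0 < c) (h : c ≤ g) : nextCoef N κ c ≤ g := by
  refine nextCoef_le hc hg.le ?_
  have h₁ : 1 / (2 * N) = κ * g ^ 2 := by rw [div_eq_iff (by positivity)]; linarith
  have h₂ : κ * g ≤ 1 := by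
    by_contra! h₃
    have h₄ : 1 < g := by nlinarith
    nlinarith [mul_lt_mul h₃ h₄.le one_pos (by linarith)]
  rw [h₁]
  nlinarith [mul_nonneg (sub_nonneg.2 h₂) (mul_nonneg (sub_nonneg.2 h) (add_pos hc hg).le)]

/-- With `d = 1/(8N)` the hypothesis says `κc² ≤ d`, so the slope `4d - κc²` is at least `3d`, which
beats the growth `2cd + d²` of the square. -/
theorem add_le_nextCoef (hN : 1 ≤ N) (hc : 0 < c) (h : 8 * N * κ * c ^ 2 ≤ 1) :
    c + 1 / (8 * N) ≤ nextCoef N κ c := by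
  have hd : 0 < 1 / (8 * N) := by positivity
  refine le_nextCoef hc (by positivity) ?_
  have h₁ : κ * c ^ 2 ≤ 1 / (8 * N) := by rw [le_div_iff₀ (by positivity)]; linarith
  have h₂ : 1 / (2 * N) = 4 * (1 / (8 * N)) := by field_simp; norm_num
  rw [h₂]
  nlinarith [mul_nonneg (sub_nonneg.2 h₁) (add_pos hc hd).le, mul_pos hc hd]

end NextCoef

/-- The ratios `a_k / b_k`. -/
noncomputable def coef (N κ : ℝ) : ℕ → ℝ
  | 0 => 1 / (4 * N)
  | k + 1 => nextCoef N κ (coef N κ k)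

/-- The coefficients `β_k`. -/
noncomputable def contraction (N κ : ℝ) (k : ℕ) : ℝ := 1 - coef N κ (k + 1) * κ

/-- The products `β_0 ⋯ β_{k-1}`. -/
noncomputable def decay (N κ : ℝ) (k : ℕ) : ℝ := ∏ j ∈ Finset.range k, contraction N κ j

/-- The coefficients `α_k`. -/
noncomputable def mixing (N κ : ℝ) (k : ℕ) : ℝ :=
  coef N κ (k + 1) / (coef N κ (k + 1) + 2 * N * coef N κ k ^ 2)

section Coef

variable {N κ g : ℝ}

theorem coef_pos (hN : 1 ≤ N) (k : ℕ) : 0 < coef N κ k := by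
  induction k with
  | zero => rw [coef]; positivity
  | succ k ih => exact nextCoef_pos ih

theorem coef_eq (k : ℕ) : coef N κ (k + 1) ^ 2 - coef N κ (k + 1) / (2 * N) =
    contraction N κ k * coef N κ k ^ 2 := nextCoef_eq

theorem contraction_pos (hN : 1 ≤ N) (hκ : 0 < κ) (hκ' : κ ≤ 1) (k : ℕ) : 0 < contraction N κ k :=
  sub_pos.2 (nextCoef_mul_lt_one hN hκ hκ' (coef_pos hN k))

theorem contraction_le_one (hN : 1 ≤ N) (hκ : 0 < κ) (k : ℕ) : contraction N κ k ≤ 1 :=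
  sub_le_self _ (mul_pos (coef_pos hN _) hκ).le

theorem decay_pos (hN : 1 ≤ N) (hκ : 0 < κ) (hκ' : κ ≤ 1) (k : ℕ) : 0 < decay N κ k :=
  Finset.prod_pos fun j _ => contraction_pos hN hκ hκ' j

theorem decay_le_one (hN : 1 ≤ N) (hκ : 0 < κ) (hκ' : κ ≤ 1) (k : ℕ) : decay N κ k ≤ 1 :=
  Finset.prod_le_one (fun j _ => (contraction_pos hN hκ hκ' j).le)
    fun j _ => contraction_le_one hN hκ j

theorem coef_le_fixed (hN : 1 ≤ N) (hκ : 0 < κ) (hκ' : κ ≤ 1) (hg : 0 < g)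
    (hgg : 2 * N * κ * g ^ 2 = 1) (k : ℕ) : coef N κ k ≤ g := by
  induction k with
  | zero =>
    by_contra! h
    rw [coef] at h
    have h₁ : g * (4 * N) < 1 := by rwa [lt_div_iff₀ (by positivity)] at h
    have h₂ : 0 < N * g := by positivity
    nlinarith [mul_pos (sub_pos.2 h₁) h₂, mul_pos h₂ hg, mul_pos (mul_pos h₂ hg) hκ]
  | succ k ih => exact nextCoef_le_fixed hN hκ' hg hgg (coef_pos hN k) ih

/-- Linear growth until the level `g/2` is reached. Above that level the bound `c_k ≤ g` makes the
sequence nondecreasing, so it never falls back. -/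
theorem min_le_coef (hN : 1 ≤ N) (hκ : 0 < κ) (hκ' : κ ≤ 1) (hg : 0 < g)
    (hgg : 2 * N * κ * g ^ 2 = 1) (k : ℕ) : min (g / 2) (k / (8 * N)) ≤ coef N κ k := by
  induction k with
  | zero => simpa using Or.inr (coef_pos hN 0).le
  | succ k ih =>
    have hck := coef_pos (κ := κ) hN k
    rcases le_total (g / 2) (coef N κ k) with h | h
    · have hle := coef_le_fixed hN hκ hκ' hg hgg k
      refine (min_le_left _ _).trans (h.trans (self_le_nextCoef hN hck ?_))
      rw [← hgg]
      gcongr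
    · have h₁ : 8 * N * κ * coef N κ k ^ 2 ≤ 1 := by
        calc 8 * N * κ * coef N κ k ^ 2 ≤ 8 * N * κ * (g / 2) ^ 2 := by gcongr
          _ = 1 := by rw [← hgg]; ring
      have h₂ := add_le_nextCoef hN hck h₁
      rcases min_le_iff.1 ih with h₃ | h₃
      · exact (min_le_left _ _).trans (h₃.trans ((le_add_of_nonneg_right (by positivity)).trans h₂))
      · refine (min_le_right _ _).trans (le_trans ?_ h₂)
        push_cast
        rw [add_div]
        gcongr

theorem half_le_coef (hN : 1 ≤ N) (hκ : 0 < κ) (hκ' : κ ≤ 1) (hg : 0 < g)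
    (hgg : 2 * N * κ * g ^ 2 = 1) {k : ℕ} (hk : 4 * N * g ≤ k) : g / 2 ≤ coef N κ k := by
  have h := min_le_coef hN hκ hκ' hg hgg k
  rwa [min_eq_left] at h
  rw [le_div_iff₀ (by positivity)]
  linarith

/-- Each step taken after `c` has passed `g/2` contributes a factor at most `1 - κg/2 ≤ exp(-κg/2)`.
-/
theorem decay_le (hN : 1 ≤ N) (hκ : 0 < κ) (hκ' : κ ≤ 1) (hg : 0 < g)
    (hgg : 2 * N * κ * g ^ 2 = 1) (k : ℕ) :
    decay N κ k ≤ Real.exp (-(κ * g / 2) * (k - 4 * N * g - 1)) := by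
  induction k with
  | zero =>
    refine (decay_le_one hN hκ hκ' 0).trans (Real.one_le_exp ?_)
    have : 0 < κ * g * (4 * N * g + 1) := by positivity
    push_cast
    linarith
  | succ k ih =>
    by_cases hk : 4 * N * g ≤ k
    · rw [decay, Finset.prod_range_succ, ← decay]
      have h₁ : contraction N κ k ≤ Real.exp (-(κ * g / 2)) := by
        refine le_trans ?_ (Real.add_one_le_exp _)
        have := half_le_coef hN hκ hκ' hg hgg (k := k + 1) (by push_cast; linarith)
        unfold contraction
        nlinarith [mul_le_mul_of_nonneg_right this hκ.le]
      calc decay N κ k * contraction N κ k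
          ≤ Real.exp (-(κ * g / 2) * (k - 4 * N * g - 1)) * Real.exp (-(κ * g / 2)) :=
            mul_le_mul ih h₁ (contraction_pos hN hκ hκ' k).le (Real.exp_pos _).le
        _ = _ := by rw [← Real.exp_add]; push_cast; ring_nf
    -- During the warm-up the exponent is nonnegative, thanks to the shift by `1`, so the trivial
    -- bound `B ≤ 1` suffices.
    · refine (decay_le_one hN hκ hκ' _).trans (Real.one_le_exp ?_)
      push_cast
      have : 0 < κ * g := by positivity
      nlinarith

/-- Once `k` is large enough, the stopping criterion `3 B_k ≤ 4 N κ ε² c_k²` holds. -/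
theorem criterion_of_le (hN : 1 ≤ N) (hκ : 0 < κ) (hκ' : κ ≤ 1) (hg : 0 < g)
    (hgg : 2 * N * κ * g ^ 2 = 1) {ε : ℝ} (hε : 0 < ε) (hε' : ε ≤ 1 / 2) {k : ℕ}
    (hk : 4 * N * g + 1 + 2 / (κ * g) * (5 * Real.log (1 / ε)) ≤ k) :
    3 * decay N κ k ≤ 4 * N * κ * ε ^ 2 * coef N κ k ^ 2 := by
  have hlog : 0 ≤ Real.log (1 / ε) := Real.log_nonneg (by rw [le_div_iff₀ hε]; linarith)
  have hc := half_le_coef hN hκ hκ' hg hgg (k := k) (by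
    have : 0 ≤ 2 / (κ * g) * (5 * Real.log (1 / ε)) := by positivity
    linarith)
  have hB : decay N κ k ≤ ε ^ 5 := by
    refine (decay_le hN hκ hκ' hg hgg k).trans ?_
    have h₁ : ε ^ 5 = Real.exp (-(5 * Real.log (1 / ε))) := by
      rw [one_div, Real.log_inv, mul_neg, neg_neg, mul_comm, Real.exp_mul, Real.exp_log hε]
      norm_cast
    rw [h₁, Real.exp_le_exp]
    have h₂ : 2 / (κ * g) * (5 * Real.log (1 / ε)) ≤ k - 4 * N * g - 1 := by linarith
    have h₃ := mul_le_mul_of_nonneg_left h₂ (show 0 ≤ κ * g / 2 by positivity)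
    have h₄ : κ * g / 2 * (2 / (κ * g) * (5 * Real.log (1 / ε))) = 5 * Real.log (1 / ε) := by
      field_simp
    linarith
  have h₅ : ε ^ 3 ≤ (1 / 2) ^ 3 := by gcongr
  calc 3 * decay N κ k ≤ 3 * (ε ^ 2 * ε ^ 3) := by rw [← pow_add]; gcongr
    _ ≤ 3 * (ε ^ 2 * (1 / 2) ^ 3) := by gcongr
    _ ≤ ε ^ 2 / 2 := by nlinarith [sq_nonneg ε]
    _ = 4 * N * κ * ε ^ 2 * (g / 2) ^ 2 := by linear_combination -(ε ^ 2 / 2) * hgg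
    _ ≤ _ := by gcongr

end Coef

end ACDM

/-! ### The iterates of the method on a quadratic objective -/

namespace LinSys

open Matrix ACDM

variable {n : ℕ} {A : Matrix (Fin n) (Fin n) ℝ} {b : Fin n → ℝ}

/-- The point `y_k` that belongs to the pair `z = (v_k, x_k)`. -/
noncomputable def mixPoint (κ : ℝ) (k : ℕ) (z : (Fin n → ℝ) × (Fin n → ℝ)) : Fin n → ℝ :=
  mixing n κ k • z.1 + (1 - mixing n κ k) • z.2

/-- One iteration, from `z = (v_k, x_k)` to `(v_{k+1}, x_{k+1})`, along the coordinate `i`. -/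
noncomputable def stepPair (A : Matrix (Fin n) (Fin n) ℝ) (b : Fin n → ℝ) (κ : ℝ) (k : ℕ)
    (i : Fin n) (z : (Fin n → ℝ) × (Fin n → ℝ)) : (Fin n → ℝ) × (Fin n → ℝ) :=
  (contraction n κ k • z.1 + (1 - contraction n κ k) • mixPoint κ k z -
      (coef n κ (k + 1) / modDiag A i * ((A *ᵥ mixPoint κ k z) i - b i)) • Pi.single i 1,
    mixPoint κ k z - (1 / modDiag A i * ((A *ᵥ mixPoint κ k z) i - b i)) • Pi.single i 1)

/-- The pair `(v_k, x_k)` after `k` iterations along the coordinates `j 0, …, j (k - 1)`. -/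
noncomputable def iterPair (A : Matrix (Fin n) (Fin n) ℝ) (b : Fin n → ℝ) (κ : ℝ)
    (x₀ : Fin n → ℝ) (j : ℕ → Fin n) : ℕ → (Fin n → ℝ) × (Fin n → ℝ)
  | 0 => (x₀, x₀)
  | k + 1 => stepPair A b κ k (j k) (iterPair A b κ x₀ j k)

/-- The ratio of the convexity parameter and the sum of the modified coordinate constants. -/
noncomputable def ratio (A : Matrix (Fin n) (Fin n) ℝ) (b : Fin n → ℝ) : ℝ :=
  convexityParam (objective A b) 1 / modTrace A

theorem ratio_pos (hA : A.PosDef) (hn : 0 < n) : 0 < ratio A b :=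
  div_pos (convexityParam_pos hA hn) (modTrace_pos hA hn)

theorem mul_convexityParam_le_modTrace (hA : A.PosDef) :
    n * convexityParam (objective A b) 1 ≤ modTrace A :=
  (mul_convexityParam_le_trace hA.isHermitian).trans trace_le_modTrace

theorem ratio_le_one (hA : A.PosDef) (hn : 0 < n) : ratio A b ≤ 1 := by
  rw [ratio, div_le_one (modTrace_pos hA hn)]
  refine le_trans ?_ (mul_convexityParam_le_modTrace (b := b) hA)
  exact le_mul_of_one_le_left (convexityParam_pos hA hn).le (by exact_mod_cast hn)

/-- The run of the method along the coordinates `j`. -/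
noncomputable def runTrace (A : Matrix (Fin n) (Fin n) ℝ) (b x₀ : Fin n → ℝ) (j : ℕ → Fin n) :
    Trace n where
  a k := coef n (ratio A b) k * (2 / √(decay n (ratio A b) k))
  b k := 2 / √(decay n (ratio A b) k)
  al k := mixing n (ratio A b) k
  be k := contraction n (ratio A b) k
  ga k := coef n (ratio A b) (k + 1)
  v k := (iterPair A b (ratio A b) x₀ j k).1
  x k := (iterPair A b (ratio A b) x₀ j k).2
  y k := mixPoint (ratio A b) k (iterPair A b (ratio A b) x₀ j k)

/-- Since `a_k/b_k` is the scalar `coef`, the prescribed identities reduce to its recursion; the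
recurrence for `b` telescopes to `2/√B_k`. -/
theorem isRun_runTrace (hA : A.PosDef) (hn : 0 < n) (x₀ : Fin n → ℝ) (j : ℕ → Fin n) :
    IsRun (objective A b) 1 x₀ j (runTrace A b x₀ j) := by
  have hN : (1 : ℝ) ≤ n := by exact_mod_cast hn
  have hκ := ratio_pos (b := b) hA hn
  have hκ' := ratio_le_one (b := b) hA hn
  have hc (k) : 0 < coef n (ratio A b) k := coef_pos hN k
  have hd (k) : 0 < decay n (ratio A b) k := decay_pos hN hκ hκ' k
  have hquot (k) : (runTrace A b x₀ j).a k ^ 2 / (runTrace A b x₀ j).b k ^ 2 =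
      coef n (ratio A b) k ^ 2 := by
    have := Real.sqrt_pos.2 (hd k)
    simp only [runTrace]
    field_simp
  have hbe (k) : 1 - (runTrace A b x₀ j).ga k * convexityParam (objective A b) 1 /
      modTotal (objective A b) 1 = (runTrace A b x₀ j).be k := by
    rw [modTotal_objective hA, mul_div_assoc]
    rfl
  refine ⟨rfl, rfl, ?_, ?_, fun k => ?_, fun k => ?_, fun k => ?_, fun k => ?_, fun k => rfl,
    fun k => ?_, fun k => ?_, fun k => ?_, fun k => rfl⟩
  · simp only [runTrace, coef, decay, Finset.range_zero, Finset.prod_empty, Real.sqrt_one]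
    field_simp
    norm_num
  · simp [runTrace, decay]
  · exact nextCoef_ge hN hκ' (hc k)
  · rw [hbe, hquot]
    exact coef_eq k
  · rw [hbe]
  · rw [hquot]
    have h₁ := hc k
    have h₂ := hc (k + 1)
    simp only [runTrace, mixing]
    field_simp
    ring
  · simp only [modLipschitz_objective hA, partialDeriv_objective hA.isHermitian]
    rfl
  · simp only [modLipschitz_objective hA, partialDeriv_objective hA.isHermitian]
    rfl
  · have h : decay n (ratio A b) (k + 1) = decay n (ratio A b) k * contraction n (ratio A b) k :=
      Finset.prod_range_succ _ _
    simp only [runTrace, h]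
    rw [Real.sqrt_mul (hd k).le, div_div]

/-- The potential function of the analysis. -/
noncomputable def potential (A : Matrix (Fin n) (Fin n) ℝ) (b xs : Fin n → ℝ) (k : ℕ)
    (z : (Fin n → ℝ) × (Fin n → ℝ)) : ℝ :=
  (z.1 - xs) ⬝ᵥ (z.1 - xs) + 4 * n * coef n (ratio A b) k ^ 2 / modTrace A *
    (objective A b z.2 - objective A b xs)

/-- The expansion of `f` along `e_i` is exact with curvature `A i i ≤ L̃_i`, so the step `1/L̃_i`
gains at least half of the first-order term. -/
theorem objective_sub_single_le (hA : A.PosDef) (y : Fin n → ℝ) (i : Fin n) :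
    objective A b (y - (1 / modDiag A i * ((A *ᵥ y) i - b i)) • Pi.single i 1) ≤
      objective A b y - ((A *ᵥ y) i - b i) ^ 2 / (2 * modDiag A i) := by
  rw [sub_eq_add_neg, ← neg_smul, objective_add hA.isHermitian]
  have hd := modDiag_pos hA i
  simp only [dotProduct_smul, mulVec_smul, smul_dotProduct, mulVec_single_one,
    dotProduct_single_one, single_one_dotProduct, col_apply, smul_eq_mul, Pi.sub_apply]
  set g := (A *ᵥ y) i - b i
  have h : A i i / modDiag A i ≤ 1 := (div_le_one hd).2 (diag_le_modDiag i)
  have h₁ : 1 / 2 * (-(1 / modDiag A i * g) * (-(1 / modDiag A i * g) * A i i)) =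
      A i i / modDiag A i * (g ^ 2 / (2 * modDiag A i)) := by
    field_simp
  have h₂ : -(1 / modDiag A i * g) * g = -2 * (g ^ 2 / (2 * modDiag A i)) := by
    field_simp
  rw [h₁, h₂]
  nlinarith [mul_le_mul_of_nonneg_right h (show 0 ≤ g ^ 2 / (2 * modDiag A i) by positivity)]

theorem convex_bound (hA : A.PosDef) (x y : Fin n → ℝ) :
    objective A b y + (A *ᵥ y - b) ⬝ᵥ (x - y) +
      convexityParam (objective A b) 1 / 2 * ((x - y) ⬝ᵥ (x - y)) ≤ objective A b x := by
  have h := objective_add (b := b) hA.isHermitian y (x - y)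
  rw [add_sub_cancel] at h
  linarith [convexityParam_mul_le (b := b) hA.isHermitian (x - y)]

/-- The left side is the conditional expectation of the next potential. Weighting by `L̃_i/S̃`
cancels the `1/L̃_i` of the `v`-step, so the cross terms add up to the full inner product with the
gradient. -/
theorem sum_potential_le (hA : A.PosDef) (hn : 0 < n) (xs : Fin n → ℝ) (k : ℕ)
    (z : (Fin n → ℝ) × (Fin n → ℝ)) :
    ∑ i, modDiag A i / modTrace A * potential A b xs (k + 1) (stepPair A b (ratio A b) k i z) ≤
      contraction n (ratio A b) k * potential A b xs k z := by
  have hN : (1 : ℝ) ≤ n := by exact_mod_cast hn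
  have hκ := ratio_pos (b := b) hA hn
  have hκ' := ratio_le_one (b := b) hA hn
  have hc : 0 < coef n (ratio A b) k := coef_pos hN k
  have hγ : 0 < coef n (ratio A b) (k + 1) := coef_pos hN (k + 1)
  have hS := modTrace_pos hA hn
  have hβ := contraction_pos hN hκ hκ' k
  have hβ' := contraction_le_one hN hκ k
  have hrec := coef_eq (N := n) (κ := ratio A b) k
  have hβdef : 1 - contraction n (ratio A b) k =
      coef n (ratio A b) (k + 1) * convexityParam (objective A b) 1 / modTrace A := by
    rw [contraction, ratio]
    ring
  set y := mixPoint (ratio A b) k z with hy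
  set S := modTrace A
  set σ := convexityParam (objective A b) 1
  set γ := coef n (ratio A b) (k + 1) with hγdef
  set c := coef n (ratio A b) k with hcdef
  set β := contraction n (ratio A b) k
  set g := A *ᵥ y - b with hg
  set w := β • z.1 + (1 - β) • y with hw
  -- the contribution of each coordinate
  have hterm (i : Fin n) : modDiag A i / S *
      potential A b xs (k + 1) (stepPair A b (ratio A b) k i z) ≤
      modDiag A i / S * ((w - xs) ⬝ᵥ (w - xs) + 4 * n * γ ^ 2 / S *
        (objective A b y - objective A b xs)) - 2 * γ / S * (g i * (w - xs) i) := by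
    have hd := modDiag_pos hA i
    have hv : (stepPair A b (ratio A b) k i z).1 - xs =
        (w - xs) - (γ / modDiag A i * g i) • Pi.single i 1 := by
      simp only [stepPair, ← hy]
      rw [sub_right_comm]
      rfl
    have hx : objective A b (stepPair A b (ratio A b) k i z).2 ≤
        objective A b y - g i ^ 2 / (2 * modDiag A i) := objective_sub_single_le hA y i
    rw [potential, ← hγdef, hv]
    have hsq : ((w - xs) - (γ / modDiag A i * g i) • Pi.single i (1 : ℝ)) ⬝ᵥ
        ((w - xs) - (γ / modDiag A i * g i) • Pi.single i (1 : ℝ)) = (w - xs) ⬝ᵥ (w - xs) -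
          2 * (γ / modDiag A i * g i) * (w - xs) i + (γ / modDiag A i * g i) ^ 2 := by
      simp only [sub_dotProduct, dotProduct_sub, smul_dotProduct, dotProduct_smul, smul_eq_mul,
        dotProduct_single_one, single_one_dotProduct, Pi.sub_apply, Pi.smul_apply,
        Pi.single_eq_same]
      ring
    rw [hsq]
    -- The quadratic term of the `v`-step is paid for by the decrease of `f`; this is where `S̃ ≤ 2n
    -- L̃_i` enters.
    have hle : (γ / modDiag A i * g i) ^ 2 ≤
        4 * n * γ ^ 2 / S * (g i ^ 2 / (2 * modDiag A i)) := by
      have h₁ : (γ / modDiag A i * g i) ^ 2 = γ ^ 2 * g i ^ 2 / modDiag A i * (1 / modDiag A i) := by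
        field_simp
      have h₂ : 4 * n * γ ^ 2 / S * (g i ^ 2 / (2 * modDiag A i)) =
          γ ^ 2 * g i ^ 2 / modDiag A i * (2 * n / S) := by
        field_simp
        ring
      have h₃ : 1 / modDiag A i ≤ 2 * n / S := by
        rw [div_le_div_iff₀ hd hS, one_mul]
        exact modTrace_le_modDiag hA hn i
      rw [h₁, h₂]
      exact mul_le_mul_of_nonneg_left h₃ (by positivity)
    have hmain : (w - xs) ⬝ᵥ (w - xs) - 2 * (γ / modDiag A i * g i) * (w - xs) i +
        (γ / modDiag A i * g i) ^ 2 + 4 * n * γ ^ 2 / S *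
          (objective A b (stepPair A b (ratio A b) k i z).2 - objective A b xs) ≤
        (w - xs) ⬝ᵥ (w - xs) + 4 * n * γ ^ 2 / S * (objective A b y - objective A b xs) -
          2 * (γ / modDiag A i * g i) * (w - xs) i := by
      nlinarith [mul_le_mul_of_nonneg_left hx (show 0 ≤ 4 * n * γ ^ 2 / S by positivity)]
    refine (mul_le_mul_of_nonneg_left hmain (div_nonneg hd.le hS.le)).trans (le_of_eq ?_)
    field_simp
  refine (Finset.sum_le_sum fun i _ => hterm i).trans ?_
  rw [Finset.sum_sub_distrib, ← Finset.sum_mul, ← Finset.sum_div, ← modTrace, div_self hS.ne',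
    one_mul, ← Finset.mul_sum]
  change _ - 2 * γ / S * (g ⬝ᵥ (w - xs)) ≤ _
  -- convexity
  have hW : (w - xs) ⬝ᵥ (w - xs) ≤
      β * ((z.1 - xs) ⬝ᵥ (z.1 - xs)) + (1 - β) * ((y - xs) ⬝ᵥ (y - xs)) := by
    have hid : β * ((z.1 - xs) ⬝ᵥ (z.1 - xs)) + (1 - β) * ((y - xs) ⬝ᵥ (y - xs)) -
        (w - xs) ⬝ᵥ (w - xs) = β * (1 - β) * ((z.1 - y) ⬝ᵥ (z.1 - y)) := by
      simp only [hw, dotProduct, Finset.mul_sum, ← Finset.sum_add_distrib, ← Finset.sum_sub_distrib]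
      refine Finset.sum_congr rfl fun i _ => ?_
      simp only [Pi.sub_apply, Pi.add_apply, Pi.smul_apply, smul_eq_mul]
      ring
    have hnn : 0 ≤ (z.1 - y) ⬝ᵥ (z.1 - y) := Finset.sum_nonneg fun i _ => mul_self_nonneg _
    nlinarith [mul_nonneg (mul_nonneg hβ.le (sub_nonneg.2 hβ')) hnn]
  -- The choice of `α` means `γ(v - y) = 2nc²(y - x)`, which trades the unknown `v` for two
  -- differences that convexity controls.
  have hgw : γ * (g ⬝ᵥ (w - xs)) =
      γ * (g ⬝ᵥ (y - xs)) + β * (2 * n * c ^ 2) * (g ⬝ᵥ (y - z.2)) := by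
    simp only [dotProduct, Finset.mul_sum, ← Finset.sum_add_distrib]
    refine Finset.sum_congr rfl fun i _ => ?_
    have hden : γ + 2 * n * c ^ 2 ≠ 0 := by positivity
    simp only [hw, hy, mixPoint, mixing, ← hγdef, ← hcdef, Pi.sub_apply, Pi.add_apply,
      Pi.smul_apply, smul_eq_mul]
    field_simp
    ring
  have hc₁ := convex_bound (b := b) hA xs y
  have hc₂ := convex_bound (b := b) hA z.2 y
  have hn₁ : g ⬝ᵥ (xs - y) = -(g ⬝ᵥ (y - xs)) := by rw [← dotProduct_neg, neg_sub]
  have hn₂ : g ⬝ᵥ (z.2 - y) = -(g ⬝ᵥ (y - z.2)) := by rw [← dotProduct_neg, neg_sub]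
  have hn₃ : (xs - y) ⬝ᵥ (xs - y) = (y - xs) ⬝ᵥ (y - xs) := by
    rw [← neg_sub, neg_dotProduct, dotProduct_neg, neg_neg]
  have hnn : 0 ≤ σ / 2 * ((z.2 - y) ⬝ᵥ (z.2 - y)) :=
    mul_nonneg (div_nonneg (convexityParam_pos hA hn).le two_pos.le)
      (Finset.sum_nonneg fun i _ => mul_self_nonneg _)
  rw [← hg, hn₁, hn₃] at hc₁
  rw [← hg, hn₂] at hc₂
  rw [potential, ← hcdef, show 2 * γ / S * (g ⬝ᵥ (w - xs)) = 2 / S * (γ * (g ⬝ᵥ (w - xs))) by ring,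
    hgw]
  set Fy := objective A b y
  set Fx := objective A b z.2
  set Fs := objective A b xs
  set Y := (y - xs) ⬝ᵥ (y - xs)
  set V := (z.1 - xs) ⬝ᵥ (z.1 - xs)
  have h₁ : 2 / S * (γ * (Fy - Fs + σ / 2 * Y) + β * (2 * n * c ^ 2) * (Fy - Fx)) ≤
      2 / S * (γ * (g ⬝ᵥ (y - xs)) + β * (2 * n * c ^ 2) * (g ⬝ᵥ (y - z.2))) := by
    refine mul_le_mul_of_nonneg_left (add_le_add ?_ ?_) (by positivity)
    · exact mul_le_mul_of_nonneg_left (by linarith) hγ.le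
    · exact mul_le_mul_of_nonneg_left (by linarith) (by positivity)
  have hrec' : 2 * n * γ ^ 2 - γ = β * (2 * n * c ^ 2) := by
    have : γ / (2 * n) * (2 * n) = γ := by field_simp
    linear_combination 2 * (n : ℝ) * hrec + this
  -- The multiples of `Y` cancel because `1 - β = γσ/S̃`, and those of `Fy` by the recursion for
  -- `γ`.
  have h₂ : (1 - β) * Y + 4 * n * γ ^ 2 / S * (Fy - Fs) -
      2 / S * (γ * (Fy - Fs + σ / 2 * Y) + β * (2 * n * c ^ 2) * (Fy - Fx)) =
      β * (4 * n * c ^ 2 / S * (Fx - Fs)) := by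
    rw [hβdef]
    field_simp
    linear_combination (2 * (Fy - Fs)) * hrec'
  linarith

end LinSys

/-! ### Random coordinates -/

namespace ACDM

open MeasureTheory ProbabilityTheory

/-- The point reached from `z₀` after `k` steps with the choices `j 0, …, j (k - 1)`. -/
def path {ι Z : Type*} (step : ℕ → ι → Z → Z) (z₀ : Z) (j : ℕ → ι) : ℕ → Z
  | 0 => z₀
  | k + 1 => step k (j k) (path step z₀ j k)

section Path

variable {ι Z Ω : Type*} {step : ℕ → ι → Z → Z} {z₀ : Z}

theorem path_congr {j j' : ℕ → ι} {k : ℕ} (h : ∀ l < k, j l = j' l) :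
    path step z₀ j k = path step z₀ j' k := by
  induction k with
  | zero => rfl
  | succ k ih => rw [path, path, h k k.lt_succ_self, ih fun l hl => h l (hl.trans k.lt_succ_self)]

/-- A function of the point after `k` steps is a function of the first `k` choices. -/
theorem exists_eq_history [Nonempty ι] {β : Type*} (G : Z → β) (k : ℕ) :
    ∃ H : (Finset.range k → ι) → β, ∀ j : ℕ → ι,
      G (path step z₀ j k) = H fun l : Finset.range k => j l := by
  classical
  refine ⟨fun h => G (path step z₀ (fun l => if hl : l ∈ Finset.range k then h ⟨l, hl⟩ else
    Classical.arbitrary ι) k), fun j => ?_⟩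
  exact congrArg G (path_congr fun l hl => by simp [hl])

variable [Fintype ι] [MeasurableSpace ι] [MeasurableSingletonClass ι] [Nonempty ι]
  [MeasurableSpace Ω] {μ : Measure Ω} {idx : ℕ → Ω → ι}

/-- The integrand depends on finitely many choices from a finite set, so it takes finitely many
values. No measurable structure on `Z` is needed. -/
theorem integrable_path [IsProbabilityMeasure μ] (hidx : ∀ k, Measurable (idx k)) (G : Z → ℝ) (k : ℕ) :
    Integrable (fun ω => G (path step z₀ (fun l => idx l ω) k)) μ := by
  obtain ⟨H, hH⟩ := exists_eq_history (step := step) (z₀ := z₀) G k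
  simp only [hH]
  have hm : Measurable fun ω (l : Finset.range k) => idx l ω :=
    measurable_pi_lambda _ fun l => hidx l
  obtain ⟨C, hC⟩ := (Set.finite_range fun h => ‖H h‖).bddAbove
  refine .of_bound ((measurable_of_finite H).comp hm).aestronglyMeasurable C
    (.of_forall fun ω => hC ⟨_, rfl⟩)

theorem indepFun_path (hidx : ∀ k, Measurable (idx k)) (hind : iIndepFun idx μ) (G : Z → ℝ)
    (F : ι → ℝ) (k : ℕ) :
    IndepFun (fun ω => F (idx k ω)) (fun ω => G (path step z₀ (fun l => idx l ω) k)) μ := by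
  obtain ⟨H, hH⟩ := exists_eq_history (step := step) (z₀ := z₀) G k
  simp only [hH]
  have h := hind.indepFun_finset {k} (Finset.range k) (by simp) hidx
  exact h.comp (φ := fun f : ({k} : Finset ℕ) → ι => F (f ⟨k, Finset.mem_singleton_self k⟩))
    (ψ := H) (measurable_of_finite _) (measurable_of_finite _)

/-- Split according to the value of the `k`-th choice. Its indicator is independent of the point
reached before, so each expectation factors. -/
theorem integral_path_succ_le [IsProbabilityMeasure μ] {p : ι → ℝ} (hidx : ∀ k, Measurable (idx k))
    (hind : iIndepFun idx μ) (hp : ∀ k i, μ.real {ω | idx k ω = i} = p i) {Φ Ψ : Z → ℝ} {k : ℕ}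
    (h : ∀ z, ∑ i, p i * Ψ (step k i z) ≤ Φ z) :
    ∫ ω, Ψ (path step z₀ (fun l => idx l ω) (k + 1)) ∂μ ≤
      ∫ ω, Φ (path step z₀ (fun l => idx l ω) k) ∂μ := by
  classical
  let F (i : ι) : ι → ℝ := fun i' => if i' = i then 1 else 0
  let z (ω : Ω) : Z := path step z₀ (fun l => idx l ω) k
  have hF (i : ι) : ∫ ω, F i (idx k ω) ∂μ = p i := by
    have : (fun ω => F i (idx k ω)) = Set.indicator {ω | idx k ω = i} 1 := by
      ext ω
      simp [F, Set.indicator_apply]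
    exact (congrArg (integral μ) this).trans
      ((integral_indicator_one (hidx k (measurableSet_singleton i))).trans (hp k i))
  have hFint (i : ι) : Integrable (fun ω => F i (idx k ω)) μ := by
    refine .of_bound ((measurable_of_finite (F i)).comp (hidx k)).aestronglyMeasurable 1
      (.of_forall fun ω => ?_)
    by_cases hi : idx k ω = i <;> simp [F, hi]
  have hG (i : ι) : Integrable (fun ω => Ψ (step k i (z ω))) μ :=
    integrable_path hidx (fun z => Ψ (step k i z)) k
  have hprod (i : ι) : Integrable (fun ω => F i (idx k ω) * Ψ (step k i (z ω))) μ :=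
    (indepFun_path hidx hind (fun z => Ψ (step k i z)) (F i) k).integrable_mul (hFint i) (hG i)
  calc ∫ ω, Ψ (path step z₀ (fun l => idx l ω) (k + 1)) ∂μ
      = ∫ ω, ∑ i, F i (idx k ω) * Ψ (step k i (z ω)) ∂μ := by
        refine integral_congr_ae (.of_forall fun ω => ?_)
        simp [F, path, z]
    _ = ∑ i, p i * ∫ ω, Ψ (step k i (z ω)) ∂μ := by
        rw [integral_finsetSum _ fun i _ => hprod i]
        refine Finset.sum_congr rfl fun i _ => ?_
        rw [← hF i]
        exact (indepFun_path hidx hind (fun z => Ψ (step k i z)) (F i)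
          k).integral_fun_mul_eq_mul_integral (hFint i).1 (hG i).1
    _ = ∫ ω, ∑ i, p i * Ψ (step k i (z ω)) ∂μ := by
        rw [integral_finsetSum _ fun i _ => (hG i).const_mul _]
        simp only [integral_const_mul]
    _ ≤ ∫ ω, Φ (z ω) ∂μ :=
        integral_mono (integrable_finsetSum _ fun i _ => (hG i).const_mul _)
          (integrable_path hidx Φ k) fun ω => h _

end Path

end ACDM

namespace LinSys

open MeasureTheory ProbabilityTheory ACDM Matrix

variable {n : ℕ} {A : Matrix (Fin n) (Fin n) ℝ} {b : Fin n → ℝ} {Ω : Type*} [MeasurableSpace Ω]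
  {μ : Measure Ω} [IsProbabilityMeasure μ] {idx : ℕ → Ω → Fin n}

theorem iterPair_eq_path (κ : ℝ) (x₀ : Fin n → ℝ) (j : ℕ → Fin n) (k : ℕ) :
    iterPair A b κ x₀ j k = path (stepPair A b κ) (x₀, x₀) j k := by
  induction k with
  | zero => rfl
  | succ k ih => rw [iterPair, path, ih]

theorem integrable_iterPair (hn : 0 < n) (hidx : ∀ k, Measurable (idx k)) {κ : ℝ}
    {x₀ : Fin n → ℝ} (G : (Fin n → ℝ) × (Fin n → ℝ) → ℝ) (k : ℕ) :
    Integrable (fun ω => G (iterPair A b κ x₀ (fun l => idx l ω) k)) μ := by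
  have : Nonempty (Fin n) := ⟨⟨0, hn⟩⟩
  simp only [iterPair_eq_path]
  exact integrable_path hidx G k

theorem integral_potential_le (hA : A.PosDef) (hn : 0 < n) (hidx : ∀ k, Measurable (idx k))
    (hind : iIndepFun idx μ)
    (hp : ∀ k i, μ.real {ω | idx k ω = i} = modDiag A i / modTrace A) (x₀ xs : Fin n → ℝ) (k : ℕ) :
    ∫ ω, potential A b xs k (iterPair A b (ratio A b) x₀ (fun l => idx l ω) k) ∂μ ≤
      decay n (ratio A b) k * potential A b xs 0 (x₀, x₀) := by
  have : Nonempty (Fin n) := ⟨⟨0, hn⟩⟩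
  simp only [iterPair_eq_path]
  induction k with
  | zero => simp [path, decay]
  | succ k ih =>
    refine (integral_path_succ_le hidx hind hp (sum_potential_le hA hn xs k)).trans ?_
    rw [integral_const_mul, decay, Finset.prod_range_succ, ← decay, mul_comm (decay _ _ _),
      mul_assoc]
    exact mul_le_mul_of_nonneg_left ih (contraction_pos (by exact_mod_cast hn) (ratio_pos hA hn)
      (ratio_le_one hA hn) k).le

/-! ### The expected error in the energy norm. -/

theorem energyNorm_sq (hA : A.PosDef) (x : Fin n → ℝ) : energyNorm A x ^ 2 = x ⬝ᵥ A *ᵥ x :=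
  Real.sq_sqrt (dotProduct_mulVec_nonneg hA x)

theorem energyNorm_nonneg (x : Fin n → ℝ) : 0 ≤ energyNorm A x := Real.sqrt_nonneg _

/-- Strong convexity gives `1/σ` for the distance term. The function term contributes at most
`1/(2σ)`, because `c_0 = 1/(4n)` and `σ ≤ S̃`. -/
theorem potential_zero_le (hA : A.PosDef) (hn : 0 < n) {xs : Fin n → ℝ} (hxs : A *ᵥ xs = b)
    (x₀ : Fin n → ℝ) :
    potential A b xs 0 (x₀, x₀) ≤
      3 / (2 * convexityParam (objective A b) 1) * energyNorm A (x₀ - xs) ^ 2 := by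
  have hσ := convexityParam_pos (b := b) hA hn
  have hS := modTrace_pos hA hn
  have hN : (1 : ℝ) ≤ n := by exact_mod_cast hn
  have h₁ := convexityParam_mul_le (b := b) hA.isHermitian (x₀ - xs)
  have h₂ := mul_convexityParam_le_modTrace (b := b) hA
  have h₃ := dotProduct_mulVec_nonneg hA (x₀ - xs)
  rw [potential, objective_sub_objective hA.isHermitian hxs, energyNorm_sq hA, coef]
  set σ := convexityParam (objective A b) 1
  set E := (x₀ - xs) ⬝ᵥ A *ᵥ (x₀ - xs)
  have h₄ : (x₀ - xs) ⬝ᵥ (x₀ - xs) ≤ E / σ := by rwa [le_div_iff₀ hσ, mul_comm]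
  have h₅ : 4 * (n : ℝ) * (1 / (4 * n)) ^ 2 / modTrace A * (1 / 2 * E) ≤ E / (2 * σ) := by
    rw [show 4 * (n : ℝ) * (1 / (4 * n)) ^ 2 / modTrace A * (1 / 2 * E) =
      E / (8 * (n * modTrace A)) by field_simp; ring]
    refine div_le_div_of_nonneg_left h₃ (by positivity) ?_
    nlinarith [mul_le_mul_of_nonneg_right hN hσ.le, mul_le_mul_of_nonneg_right hN hS.le]
  calc _ ≤ E / σ + E / (2 * σ) := add_le_add h₄ h₅
    _ = _ := by field_simp; norm_num

theorem integral_energyNorm_le (hA : A.PosDef) (hn : 0 < n) (hidx : ∀ k, Measurable (idx k))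
    (hind : iIndepFun idx μ)
    (hp : ∀ k i, μ.real {ω | idx k ω = i} = modDiag A i / modTrace A) {x₀ xs : Fin n → ℝ}
    (hxs : A *ᵥ xs = b) {ε : ℝ} (hε : 0 < ε) {k : ℕ}
    (hk : 3 * decay n (ratio A b) k ≤ 4 * n * ratio A b * ε ^ 2 * coef n (ratio A b) k ^ 2) :
    ∫ ω, energyNorm A ((iterPair A b (ratio A b) x₀ (fun l => idx l ω) k).2 - xs) ∂μ ≤
      ε * energyNorm A (x₀ - xs) := by
  have hσ := convexityParam_pos (b := b) hA hn
  have hS := modTrace_pos hA hn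
  have hN : (0 : ℝ) < n := by exact_mod_cast hn
  have hc : 0 < coef n (ratio A b) k := coef_pos (by exact_mod_cast hn) k
  have hB : 0 < decay n (ratio A b) k :=
    decay_pos (by exact_mod_cast hn) (ratio_pos hA hn) (ratio_le_one hA hn) k
  set X : Ω → ℝ := fun ω =>
    energyNorm A ((iterPair A b (ratio A b) x₀ (fun l => idx l ω) k).2 - xs) with hX
  set E := energyNorm A (x₀ - xs)
  have hXint : Integrable X μ := integrable_iterPair hn hidx (fun z => energyNorm A (z.2 - xs)) k
  have hX2int : Integrable (fun ω => X ω ^ 2) μ :=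
    integrable_iterPair hn hidx (fun z => energyNorm A (z.2 - xs) ^ 2) k
  have hpot : 2 * n * coef n (ratio A b) k ^ 2 / modTrace A * ∫ ω, X ω ^ 2 ∂μ ≤
      decay n (ratio A b) k * (3 / (2 * convexityParam (objective A b) 1) * E ^ 2) := by
    refine le_trans ?_ ((integral_potential_le hA hn hidx hind hp x₀ xs k).trans
      (mul_le_mul_of_nonneg_left (potential_zero_le hA hn hxs x₀) hB.le))
    rw [← integral_const_mul]
    refine integral_mono (hX2int.const_mul _)
      (integrable_iterPair hn hidx (fun z => potential A b xs k z) k) fun ω => ?_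
    simp only [potential, objective_sub_objective hA.isHermitian hxs, hX, energyNorm_sq hA]
    refine le_add_of_nonneg_of_le (Finset.sum_nonneg fun i _ => mul_self_nonneg _) (le_of_eq ?_)
    ring
  have hX2 : ∫ ω, X ω ^ 2 ∂μ ≤ (ε * E) ^ 2 := by
    have h₁ : 2 * n * coef n (ratio A b) k ^ 2 / modTrace A * ∫ ω, X ω ^ 2 ∂μ ≤
        2 * n * coef n (ratio A b) k ^ 2 / modTrace A * (ε * E) ^ 2 := by
      refine hpot.trans ?_
      have h₂ := mul_le_mul_of_nonneg_right hk
        (show 0 ≤ E ^ 2 / (2 * convexityParam (objective A b) 1) by positivity)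
      calc _ = 3 * decay n (ratio A b) k * (E ^ 2 / (2 * convexityParam (objective A b) 1)) := by
            ring
        _ ≤ _ := h₂
        _ = _ := by rw [ratio]; field_simp; ring
    exact le_of_mul_le_mul_left h₁ (by positivity)
  -- The variance is nonnegative.
  have hvar : (∫ ω, X ω ∂μ) ^ 2 ≤ ∫ ω, X ω ^ 2 ∂μ := by
    set m := ∫ ω, X ω ∂μ with hm
    have hsub : Integrable (fun ω => X ω ^ 2 - 2 * m * X ω) μ := hX2int.sub (hXint.const_mul _)
    have h₁ : 0 ≤ ∫ ω, (X ω ^ 2 - 2 * m * X ω + m ^ 2) ∂μ :=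
      integral_nonneg fun ω => by
        simp only [Pi.zero_apply]
        nlinarith [sq_nonneg (X ω - m)]
    rw [integral_add hsub (integrable_const _), integral_sub hX2int (hXint.const_mul _),
      integral_const_mul, integral_const, probReal_univ, one_smul, ← hm] at h₁
    nlinarith
  exact (sq_le_sq₀ (integral_nonneg fun ω => energyNorm_nonneg _)
    (mul_nonneg hε.le (energyNorm_nonneg _))).1 (hvar.trans hX2)

end LinSys

/-! ### Sampling a coordinate by inversion -/

namespace LinSys

open MeasureTheory ProbabilityTheory Matrix

variable {n : ℕ} {A : Matrix (Fin n) (Fin n) ℝ} {b : Fin n → ℝ}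

theorem pad_apply (x : Fin n → ℝ) (i : Fin n) : pad x i = x i := by simp [pad]

/-- The sum of the first `k` modified coordinate constants. -/
noncomputable def prefixSum (A : Matrix (Fin n) (Fin n) ℝ) (k : ℕ) : ℝ :=
  ∑ l ∈ Finset.range k, pad (modDiag A) l

theorem prefixSum_zero : prefixSum A 0 = 0 := by simp [prefixSum]

theorem prefixSum_succ (i : Fin n) : prefixSum A (i + 1) = prefixSum A i + modDiag A i := by
  rw [prefixSum, Finset.sum_range_succ, pad_apply, prefixSum]

theorem prefixSum_card : prefixSum A n = modTrace A := by
  rw [prefixSum, Finset.sum_range, modTrace]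
  exact Finset.sum_congr rfl fun i _ => pad_apply _ i

theorem prefixSum_mono (hA : A.PosDef) : Monotone (prefixSum A) := by
  refine monotone_nat_of_le_succ fun k => ?_
  rw [prefixSum, prefixSum, Finset.sum_range_succ]
  refine le_add_of_nonneg_right ?_
  unfold pad
  split_ifs
  · exact (modDiag_pos hA _).le
  · exact le_rfl

/-- The coordinate whose interval of partial sums contains `t`. -/
noncomputable def pick (A : Matrix (Fin n) (Fin n) ℝ) (hn : 0 < n) (t : ℝ) : Fin n :=
  open Classical in
  ⟨Nat.findGreatest (fun l => prefixSum A l ≤ t) (n - 1),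
    (Nat.findGreatest_le _).trans_lt (Nat.sub_lt hn one_pos)⟩

/-- The last coordinate has no upper condition: it also receives the endpoint `t = S̃`, which the
draw `1` produces. -/
theorem pick_eq_iff (hA : A.PosDef) (hn : 0 < n) {t : ℝ} (ht : 0 ≤ t) (i : Fin n) :
    pick A hn t = i ↔ prefixSum A i ≤ t ∧ ((i : ℕ) + 1 < n → t < prefixSum A (i + 1)) := by
  classical
  have hspec : prefixSum A (pick A hn t) ≤ t :=
    Nat.findGreatest_spec (P := fun l => prefixSum A l ≤ t) (Nat.zero_le _)
      (by rwa [prefixSum_zero])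
  have hlt (l : ℕ) (h₁ : (pick A hn t : ℕ) < l) (h₂ : l < n) : t < prefixSum A l :=
    not_le.1 (Nat.findGreatest_is_greatest (P := fun l => prefixSum A l ≤ t) h₁ (by omega))
  constructor
  · rintro rfl
    exact ⟨hspec, fun h => hlt _ (Nat.lt_succ_self _) h⟩
  · rintro ⟨h₁, h₂⟩
    rcases lt_trichotomy (pick A hn t) i with h | h | h
    · exact absurd h₁ (not_le.2 (hlt i h i.2))
    · exact h
    · have h₃ : (i : ℕ) + 1 ≤ pick A hn t := h
      exact absurd ((h₂ (h₃.trans_lt (pick A hn t).2)).trans_le (prefixSum_mono hA h₃))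
        (not_lt.2 hspec)

theorem prefixSum_le_modTrace (hA : A.PosDef) {k : ℕ} (hk : k ≤ n) :
    prefixSum A k ≤ modTrace A :=
  (prefixSum_mono hA hk).trans_eq prefixSum_card

/-- A partial sum as a fraction of the total. -/
noncomputable def quantile (hA : A.PosDef) (hn : 0 < n) (k : ℕ) (hk : k ≤ n) : unitInterval :=
  ⟨prefixSum A k / modTrace A,
    div_nonneg (prefixSum_zero.symm.le.trans (prefixSum_mono hA (Nat.zero_le k)))
      (modTrace_pos hA hn).le,
    (div_le_one (modTrace_pos hA hn)).2 (prefixSum_le_modTrace hA hk)⟩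

theorem pick_eq_iff_mem (hA : A.PosDef) (hn : 0 < n) (u : unitInterval) (i : Fin n) :
    pick A hn (u * modTrace A) = i ↔ quantile hA hn i i.2.le ≤ u ∧
      ((i : ℕ) + 1 < n → u < quantile hA hn (i + 1) i.2) := by
  have hS := modTrace_pos hA hn
  rw [pick_eq_iff hA hn (mul_nonneg u.2.1 hS.le), ← Subtype.coe_le_coe, ← Subtype.coe_lt_coe,
    quantile, quantile, div_le_iff₀ hS, lt_div_iff₀ hS]

theorem setOf_pick_eq (hA : A.PosDef) (hn : 0 < n) (i : Fin n) :
    {u : unitInterval | pick A hn (u * modTrace A) = i} =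
      if (i : ℕ) + 1 < n then
        Set.Ico (quantile hA hn i i.2.le) (quantile hA hn (i + 1) i.2)
      else Set.Ici (quantile hA hn i i.2.le) := by
  ext u
  change pick A hn (u * modTrace A) = i ↔ _
  rw [pick_eq_iff_mem hA]
  split_ifs with h <;> simp [h]

theorem measurable_pick (hA : A.PosDef) (hn : 0 < n) :
    Measurable fun u : unitInterval => pick A hn (u * modTrace A) := by
  refine measurable_to_countable' fun i => ?_
  change MeasurableSet {u : unitInterval | pick A hn (u * modTrace A) = i}
  rw [setOf_pick_eq hA hn]
  split_ifs
  exacts [measurableSet_Ico, measurableSet_Ici]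

theorem volume_pick_eq (hA : A.PosDef) (hn : 0 < n) (i : Fin n) :
    (volume : Measure unitInterval).real {u | pick A hn (u * modTrace A) = i} =
      modDiag A i / modTrace A := by
  have hS := modTrace_pos hA hn
  have hd := modDiag_pos hA i
  rw [setOf_pick_eq hA hn, measureReal_def]
  have hdiff : (prefixSum A (i + 1) - prefixSum A i) / modTrace A = modDiag A i / modTrace A := by
    rw [prefixSum_succ, add_sub_cancel_left]
  split_ifs with h
  · rw [unitInterval.volume_Ico, quantile, quantile, ← sub_div, hdiff,
      ENNReal.toReal_ofReal (by positivity)]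
  · have h₁ : (1 : ℝ) = prefixSum A (i + 1) / modTrace A := by
      rw [show (i : ℕ) + 1 = n by have := i.2; omega, prefixSum_card, div_self hS.ne']
    rw [unitInterval.volume_Ici, quantile, h₁, ← sub_div, hdiff,
      ENNReal.toReal_ofReal (by positivity)]

/-- The coordinate picked in iteration `k`. -/
noncomputable def pickIndex (A : Matrix (Fin n) (Fin n) ℝ) (hn : 0 < n) (k : ℕ)
    (ω : RAM.Coins) : Fin n :=
  pick A hn (ω k * modTrace A)

theorem measurable_pickIndex (hA : A.PosDef) (hn : 0 < n) (k : ℕ) :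
    Measurable (pickIndex A hn k) :=
  (measurable_pick hA hn).comp (measurable_pi_apply k)

instance : IsProbabilityMeasure RAM.coinMeasure := by
  unfold RAM.coinMeasure
  infer_instance

theorem iIndepFun_pickIndex (hA : A.PosDef) (hn : 0 < n) :
    iIndepFun (pickIndex A hn) RAM.coinMeasure :=
  iIndepFun_infinitePi (X := fun (_ : ℕ) (u : unitInterval) => pick A hn (u * modTrace A))
    fun _ => measurable_pick hA hn

theorem coinMeasure_pickIndex_eq (hA : A.PosDef) (hn : 0 < n) (k : ℕ) (i : Fin n) :
    RAM.coinMeasure.real {ω | pickIndex A hn k ω = i} = modDiag A i / modTrace A := by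
  have hmp := measurePreserving_eval_infinitePi (fun _ : ℕ => (volume : Measure unitInterval)) k
  rw [← volume_pick_eq hA hn i]
  exact congrArg ENNReal.toReal (hmp.measure_preimage
    ((measurable_pick hA hn) (measurableSet_singleton i)).nullMeasurableSet)

end LinSys

/-! ### Counting loops and rows of a sparse matrix -/

namespace RAM

/-- The index stored in cell `0` of array `a`. -/
abbrev natVar (a : ℕ) : NatExp := .get a (.const 0)

/-- The real number stored in cell `0` of array `a`. -/
abbrev realVar (a : ℕ) : RealExp := .get a (.const 0)

/-- Run `body` for all values of the counter `a` from `lo` up to `hi`, exclusively. -/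
abbrev countLoop (a : ℕ) (lo hi : NatExp) (body : Cmd) : Cmd :=
  .seq (.setNat a (.const 0) lo) (.loop (.natLt (natVar a) hi)
    (.seq body (.setNat a (.const 0) (.add (natVar a) (.const 1)))))

variable {ω : Coins}

theorem Runs.setNat_seq {a : ℕ} {i e : NatExp} {c : Cmd} {s : State} {R : State → Prop} {T : ℕ}
    (h : Runs ω c (s.setNat a (i.eval s) (e.eval s)) R T) :
    Runs ω (.seq (.setNat a i e) c) s R (i.cost + e.cost + 1 + T) :=
  Runs.seq (R := fun s' => Runs ω c s' R T) (Runs.setNat h) fun _ => id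

theorem Runs.setReal_seq {a : ℕ} {i : NatExp} {e : RealExp} {c : Cmd} {s : State}
    {R : State → Prop} {T : ℕ} (h : Runs ω c (s.setReal a (i.eval s) (e.eval s)) R T) :
    Runs ω (.seq (.setReal a i e) c) s R (i.cost + e.cost + 1 + T) :=
  Runs.seq (R := fun s' => Runs ω c s' R T) (Runs.setReal h) fun _ => id

theorem Runs.rand_seq {a : ℕ} {i : NatExp} {c : Cmd} {s : State} {R : State → Prop} {T : ℕ}
    (h : Runs ω c { s.setReal a (i.eval s) (ω s.draws) with draws := s.draws + 1 } R T) :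
    Runs ω (.seq (.rand a i) c) s R (i.cost + 1 + T) :=
  Runs.seq (R := fun s' => Runs ω c s' R T) (Runs.rand h) fun _ => id

theorem State.setNat_nat_self (s : State) (a i v : ℕ) : (s.setNat a i v).nat a i = v := by
  simp [State.setNat]

theorem State.setNat_nat_of_ne (s : State) {a a' : ℕ} (h : a' ≠ a) (i v : ℕ) :
    (s.setNat a i v).nat a' = s.nat a' := by
  simp [State.setNat, h]

theorem State.setReal_real_self (s : State) (a i : ℕ) (v : ℝ) : (s.setReal a i v).real a i = v := by
  simp [State.setReal]

theorem State.setReal_real_of_ne (s : State) {a a' : ℕ} (h : a' ≠ a) (i : ℕ) (v : ℝ) :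
    (s.setReal a i v).real a' = s.real a' := by
  simp [State.setReal, h]

theorem State.setReal_real_of_ne_cell (s : State) (a : ℕ) {i i' : ℕ} (h : i' ≠ i) (v : ℝ) :
    (s.setReal a i v).real a i' = s.real a i' := by
  simp [State.setReal, h]

/-- The invariant need not mention the counter or the arrays that the body leaves alone; both are
carried along internally and handed to `hstep`. The invariant is required after the counter is
written, which costs nothing for invariants about real arrays. -/
theorem runs_countLoop {a : ℕ} {lo hi : NatExp} {body : Cmd} {s : State} {l h T : ℕ}
    (I : ℕ → State → Prop) (hlo : lo.eval s = l) (hle : l ≤ h) (ha : a ∉ body.natWrites)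
    (hhi : ∀ s', (∀ a', a' ≠ a → a' ∉ body.natWrites → s'.nat a' = s.nat a') → hi.eval s' = h)
    (hI : I l (s.setNat a 0 l))
    (hstep : ∀ k s', l ≤ k → k < h → s'.nat a 0 = k →
      (∀ a', a' ≠ a → a' ∉ body.natWrites → s'.nat a' = s.nat a') →
      (∀ a', a' ∉ body.realWrites → s'.real a' = s.real a') → I k s' →
      Runs ω body s' (fun s'' => I (k + 1) (s''.setNat a 0 (k + 1))) T) :
    Runs ω (countLoop a lo hi body) s (I h)
      ((h - l) * (T + (hi.cost + 9)) + (lo.cost + hi.cost + 5)) := by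
  let J (k : ℕ) (s' : State) : Prop := s'.nat a 0 = k ∧
    (∀ a', a' ≠ a → a' ∉ body.natWrites → s'.nat a' = s.nat a') ∧
    (∀ a', a' ∉ body.realWrites → s'.real a' = s.real a') ∧ I k s'
  have hloop (s₁ : State) (h₁ : J l s₁) := Runs.loop (ω := ω) (b := .natLt (natVar a) hi)
    (c := .seq body (.setNat a (.const 0) (.add (natVar a) (.const 1)))) (I := fun j => J (l + j))
    (k := 0) (N := h - l) (T := T + 6) (s := s₁) (Nat.zero_le _) (by simpa using h₁)
    (by
      rintro j s' hj ⟨h₁, h₂, h₃, h₄⟩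
      refine ⟨?_, ?_⟩
      · simp only [Test.Holds, NatExp.eval, h₁, hhi s' h₂]
        omega
      · refine Runs.mono (Runs.seq (hstep (l + j) s' (by omega) (by omega) h₁ h₂ h₃ h₄).frame
          fun s'' h'' => Runs.setNat (R := J (l + (j + 1))) ?_) (fun _ => id)
          (by simp [NatExp.cost])
        obtain ⟨hI'', hf⟩ := h''
        have hk : s''.nat a 0 = l + j := by rw [hf.nat a ha, h₁]
        simp only [NatExp.eval, hk]
        refine ⟨State.setNat_nat_self .., fun a' h₅ h₆ => ?_, fun a' h₅ => ?_, hI''⟩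
        · rw [State.setNat_nat_of_ne _ h₅, hf.nat a' h₆, h₂ a' h₅ h₆]
        · exact (hf.real a' h₅).trans (h₃ a' h₅))
    (by
      rintro s' ⟨h₁, h₂, -⟩
      simp only [Test.Holds, NatExp.eval, h₁, hhi s' h₂]
      omega)
  refine Runs.mono (Runs.seq (R := J l) (Runs.setNat ?_) hloop) ?_ ?_
  · simp only [NatExp.eval, hlo]
    exact ⟨State.setNat_nat_self .., fun a' h₅ _ => State.setNat_nat_of_ne _ h₅ .., fun _ _ => rfl,
      hI⟩
  · rintro s' ⟨-, -, -, h₄⟩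
    rwa [Nat.add_sub_cancel' hle] at h₄
  · simp only [NatExp.cost, Test.cost, Nat.sub_zero]
    rw [show 1 + 1 + hi.cost + 1 + (T + 6) = T + (hi.cost + 9) by ring]
    omega

end RAM

namespace LinSys

open Matrix

variable {n : ℕ} {A : Matrix (Fin n) (Fin n) ℝ}

theorem SparseRep.card_row (D : SparseRep A) (i : Fin n) :
    D.ptr (i + 1) - D.ptr i = rowNnz A i := by
  rw [rowNnz, ← (D.bijOn_col i).image_eq, (D.bijOn_col i).injOn.ncard_image, Set.ncard_eq_toFinset_card']
  simp

/-- The listed columns run bijectively through the support of the row, and the omitted entries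
contribute zero. -/
theorem SparseRep.sum_row (D : SparseRep A) (i : Fin n) (y : Fin n → ℝ) :
    ∑ k ∈ Finset.Ico (D.ptr i) (D.ptr (i + 1)), D.val k * y (D.col k) = (A *ᵥ y) i := by
  classical
  have h := D.bijOn_col i
  calc ∑ k ∈ Finset.Ico (D.ptr i) (D.ptr (i + 1)), D.val k * y (D.col k)
      = ∑ k ∈ Finset.Ico (D.ptr i) (D.ptr (i + 1)), A i (D.col k) * y (D.col k) :=
        Finset.sum_congr rfl fun k hk => by rw [D.val_eq i k (by simpa using hk)]
    _ = ∑ j ∈ Finset.univ.filter fun j => A i j ≠ 0, A i j * y j := by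
        refine Finset.sum_bij (fun k _ => D.col k) (fun k hk => ?_) (fun k hk l hl hkl => ?_)
          (fun j hj => ?_) fun _ _ => rfl
        · simpa using h.mapsTo (show k ∈ Set.Ico _ _ by simpa using hk)
        · exact h.injOn (by simpa using hk) (by simpa using hl) hkl
        · obtain ⟨k, hk, rfl⟩ := h.surjOn (show j ∈ {j | A i j ≠ 0} by simpa using hj)
          exact ⟨k, by simpa using hk, rfl⟩
    _ = (A *ᵥ y) i := by
        rw [mulVec, dotProduct, Finset.sum_filter]
        refine Finset.sum_congr rfl fun j _ => ?_
        split_ifs with hj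
        · rfl
        · simp [not_not.1 hj]

theorem SparseRep.exists_diag (D : SparseRep A) {i : Fin n} (h : A i i ≠ 0) :
    ∃ k ∈ Set.Ico (D.ptr i) (D.ptr (i + 1)), D.col k = i := (D.bijOn_col i).surjOn h

end LinSys

/-! ### The program: preprocessing -/

namespace LinSys

open Matrix RAM

variable {n : ℕ} {A : Matrix (Fin n) (Fin n) ℝ} {D : SparseRep A} {b x₀ : Fin n → ℝ} {σ ε : ℝ}
  {ω : Coins} {s s' : State}

/-- The memory holds the problem data. -/
structure HasData (D : SparseRep A) (b : Fin n → ℝ) (σ ε : ℝ) (s : State) : Prop where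
  size : s.nat 0 0 = n
  ptr : s.nat 1 = D.ptr
  col : s.nat 2 = fun k => (D.col k : ℕ)
  val : s.real 0 = D.val
  rhs : s.real 1 = pad b
  conv : s.real 3 0 = σ
  eps : s.real 3 1 = ε

theorem HasData.congr (h : HasData D b σ ε s) (hnat : ∀ a < 3, s'.nat a = s.nat a)
    (hreal : ∀ a ∈ [0, 1, 3], s'.real a = s.real a) : HasData D b σ ε s' where
  size := by rw [hnat 0 (by norm_num), h.size]
  ptr := by rw [hnat 1 (by norm_num), h.ptr]
  col := by rw [hnat 2 (by norm_num), h.col]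
  val := by rw [hreal 0 (by simp), h.val]
  rhs := by rw [hreal 1 (by simp), h.rhs]
  conv := by rw [hreal 3 (by simp), h.conv]
  eps := by rw [hreal 3 (by simp), h.eps]

theorem HasData.frame {c : Cmd} (h : HasData D b σ ε s) (hf : Frame c s s')
    (hnat : ∀ a < 3, a ∉ c.natWrites) (hreal : ∀ a ∈ [0, 1, 3], a ∉ c.realWrites) :
    HasData D b σ ε s' :=
  h.congr (fun a ha => hf.nat a (hnat a ha)) fun a ha => hf.real a (hreal a ha)

theorem hasData_inputState : HasData D b σ ε (inputState D b x₀ σ ε) := by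
  constructor <;> simp [inputState]

/-- Run `body` for all positions `nat 4 0` of the row `nat 3 0`. -/
abbrev rowLoop (body : Cmd) : Cmd :=
  countLoop 4 (.get 1 (natVar 3)) (.get 1 (.add (natVar 3) (.const 1))) body

theorem runs_rowLoop {body : Cmd} {i : Fin n} {T : ℕ} (I : ℕ → State → Prop)
    (hdata : HasData D b σ ε s) (hi : s.nat 3 0 = i) (hw : body.natWrites = [])
    (hr : ∀ a ∈ [0, 1, 3], a ∉ body.realWrites) (hI : I (D.ptr i) (s.setNat 4 0 (D.ptr i)))
    (hstep : ∀ k s', D.ptr i ≤ k → k < D.ptr (i + 1) → HasData D b σ ε s' → s'.nat 4 0 = k →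
      s'.nat 3 0 = i → (∀ a, a ∉ body.realWrites → s'.real a = s.real a) → I k s' →
      Runs ω body s' (fun s'' => I (k + 1) (s''.setNat 4 0 (k + 1))) T) :
    Runs ω (rowLoop body) s (I (D.ptr (i + 1))) (rowNnz A i * (T + 14) + 13) := by
  refine Runs.mono (runs_countLoop (T := T) (l := D.ptr i) (h := D.ptr (i + 1)) I ?_ (D.ptr_le i)
    (by simp [hw]) (fun s' h => ?_) hI fun k s' h₁ h₂ h₃ h₄ h₅ h₆ => ?_) (fun _ => id) ?_
  · simp [NatExp.eval, hdata.ptr, hi]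
  · have h₁ := h 1 (by norm_num) (by simp [hw])
    have h₃ := h 3 (by norm_num) (by simp [hw])
    simp [NatExp.eval, h₁, h₃, hdata.ptr, hi]
  · refine hstep k s' h₁ h₂ (hdata.congr (fun a ha => h₄ a (by omega) (by simp [hw]))
      fun a ha => h₅ a (hr a ha)) h₃ ?_ h₅ h₆
    rw [h₄ 3 (by norm_num) (by simp [hw]), hi]
  · rw [D.card_row]
    simp [NatExp.cost]

/-- Store the current entry in `real 5` if it is a diagonal entry. -/
abbrev scanEntry : Cmd :=
  .ite (.natLt (.get 2 (natVar 4)) (natVar 3)) .skip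
    (.ite (.natLt (natVar 3) (.get 2 (natVar 4))) .skip
      (.setReal 5 (natVar 3) (.get 0 (natVar 4))))

/-- Equality of column and row is detected by two failed strict comparisons. The diagonal entry is
positive, hence listed, so the scan does find it. -/
theorem runs_scanRow (hA : A.PosDef) {i : Fin n} (hdata : HasData D b σ ε s)
    (hi : s.nat 3 0 = i) :
    Runs ω (rowLoop scanEntry) s
      (fun s' => s'.real 5 i = A i i ∧ ∀ j : ℕ, j ≠ i → s'.real 5 j = s.real 5 j)
      (rowNnz A i * 32 + 13) := by
  refine Runs.mono (runs_rowLoop (T := 18) (fun k s' =>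
    (∀ l, D.ptr i ≤ l → l < k → D.col l = i → s'.real 5 i = A i i) ∧
      ∀ j : ℕ, j ≠ i → s'.real 5 j = s.real 5 j) hdata hi rfl (by decide)
    ⟨fun l h₁ h₂ => absurd h₂ (by omega), fun _ _ => rfl⟩ ?_) ?_ le_rfl
  · rintro k s' hk hk' hd h₄ h₃ - ⟨h₅, h₆⟩
    have hskip (hne : D.col k ≠ i) : (∀ l, D.ptr i ≤ l → l < k + 1 → D.col l = i →
        (s'.setNat 4 0 (k + 1)).real 5 i = A i i) ∧
        ∀ j : ℕ, j ≠ i → (s'.setNat 4 0 (k + 1)).real 5 j = s.real 5 j := by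
      refine ⟨fun l h₁ h₂ h => h₅ l h₁ (lt_of_le_of_ne (Nat.lt_succ_iff.1 h₂) ?_) h, h₆⟩
      rintro rfl
      exact hne h
    refine Runs.mono (Runs.ite (T := 12) (fun ht => ?_) fun ht => Runs.ite (T := 6) (fun ht' => ?_)
      fun ht' => ?_) (fun _ => id) (by simp [Test.cost, NatExp.cost])
    · refine Runs.mono (Runs.skip (hskip ?_)) (fun _ => id) (by norm_num)
      rintro rfl
      simp [Test.Holds, NatExp.eval, hd.col, h₄, h₃] at ht
    · refine Runs.mono (Runs.skip (hskip ?_)) (fun _ => id) (by norm_num)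
      rintro rfl
      simp [Test.Holds, NatExp.eval, hd.col, h₄, h₃] at ht'
    · have hcol : D.col k = i := by
        simp only [Test.Holds, NatExp.eval, hd.col, h₄, h₃] at ht ht'
        exact Fin.ext (by omega)
      refine Runs.mono (Runs.setReal ?_) (fun _ => id) (by simp [NatExp.cost, RealExp.cost])
      simp only [NatExp.eval, RealExp.eval, hd.val, h₄, h₃, D.val_eq i k ⟨hk, hk'⟩, hcol]
      refine ⟨fun l _ _ _ => by simp [State.setNat, State.setReal], fun j hj => ?_⟩
      exact (State.setReal_real_of_ne_cell _ _ hj _).trans (h₆ j hj)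
  · rintro s' ⟨h₅, h₆⟩
    obtain ⟨k, hk, hcol⟩ := D.exists_diag (diag_pos hA i).ne'
    exact ⟨h₅ k hk.1 hk.2 hcol, h₆⟩

/-- Collect the diagonal in `real 5` and its sum in `real 8`, and copy the start vector. -/
abbrev diagCmd : Cmd :=
  countLoop 3 (.const 0) (natVar 0) (.seq (rowLoop scanEntry)
    (.seq (.setReal 8 (.const 0) (.add (realVar 8) (.get 5 (natVar 3))))
      (.setReal 4 (natVar 3) (.get 2 (natVar 3)))))

theorem runs_diagCmd (hA : A.PosDef) {R : ℕ} (hR : ∀ i, rowNnz A i ≤ R) :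
    Runs ω diagCmd (inputState D b x₀ σ ε)
      (fun s' => (∀ j : Fin n, s'.real 5 j = A j j ∧ s'.real 4 j = x₀ j) ∧ s'.real 8 0 = A.trace)
      (n * (R * 32 + 38) + 8) := by
  have hdata : HasData D b σ ε (inputState D b x₀ σ ε) := hasData_inputState
  refine Runs.mono (runs_countLoop (T := R * 32 + 27) (l := 0) (h := n) (fun k s' =>
    (∀ j : Fin n, (j : ℕ) < k → s'.real 5 j = A j j ∧ s'.real 4 j = x₀ j) ∧
      s'.real 8 0 = ∑ l ∈ Finset.range k, pad (fun i => A i i) l) rfl (Nat.zero_le _) (by decide)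
    (fun s' h => ?_) ?_ ?_) ?_ ?_
  · rw [NatExp.eval, h 0 (by decide) (by decide)]
    exact hdata.size
  · exact ⟨fun j hj => absurd hj (Nat.not_lt_zero _), by simp [State.setNat, inputState]⟩
  · rintro k s' - hk h₃ hnat hreal ⟨h₁, h₂⟩
    have hd : HasData D b σ ε s' := hdata.congr
      (fun a ha => hnat a (by omega) (by interval_cases a <;> decide))
      fun a ha => hreal a (by revert a; decide)
    have hx : s'.real 2 = pad x₀ := by
      rw [hreal 2 (by decide)]
      funext j
      simp [inputState]
    refine Runs.mono (Runs.seq (runs_scanRow hA (i := ⟨k, hk⟩) hd h₃).frame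
      fun s₁ hs₁ => Runs.setReal_seq (Runs.setReal ?_)) (fun _ => id) ?_
    · obtain ⟨⟨hdiag, hother⟩, hf⟩ := hs₁
      have e₃ : s₁.nat 3 0 = k := by rw [hf.nat 3 (by decide), h₃]
      have e₈ : s₁.real 8 0 = s'.real 8 0 := by rw [hf.real 8 (by decide)]
      have e₂ : s₁.real 2 = pad x₀ := by rw [hf.real 2 (by decide), hx]
      have e₄ : s₁.real 4 = s'.real 4 := hf.real 4 (by decide)
      have hk₅ : s₁.real 5 k = A ⟨k, hk⟩ ⟨k, hk⟩ := hdiag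
      have hpad : pad (fun i => A i i) k = A ⟨k, hk⟩ ⟨k, hk⟩ := pad_apply (fun i => A i i) ⟨k, hk⟩
      simp only [NatExp.eval, RealExp.eval, e₃, e₈, hk₅, State.setNat, State.setReal]
      refine ⟨fun j hj => ?_, ?_⟩
      · rcases eq_or_ne (j : ℕ) k with hjk | hjk
        · obtain rfl : j = ⟨k, hk⟩ := Fin.ext hjk
          simp [hk₅, e₂, pad, hk]
        · have := h₁ j (by omega)
          simp [hjk, e₄, hother j hjk, this]
      · simp [Finset.sum_range_succ, hpad, h₂]
    · have := hR ⟨k, hk⟩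
      simp only [NatExp.cost, RealExp.cost]
      omega
  · rintro s' ⟨h₁, h₂⟩
    refine ⟨fun j => h₁ j j.2, h₂.trans ?_⟩
    rw [Finset.sum_range, trace]
    exact Finset.sum_congr rfl fun i _ => pad_apply (fun i => A i i) i
  · simp [NatExp.cost]

/-- The memory holds the modified coordinate constants, their partial sums and their total. -/
structure HasTables (A : Matrix (Fin n) (Fin n) ℝ) (s : State) : Prop where
  diag : ∀ j : Fin n, s.real 5 j = modDiag A j
  pre : ∀ j : Fin n, s.real 6 j = prefixSum A (j + 1)
  total : s.real 9 0 = modTrace A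

theorem HasTables.congr (h : HasTables A s) (hreal : ∀ a ∈ [5, 6, 9], s'.real a = s.real a) :
    HasTables A s' where
  diag j := by rw [hreal 5 (by simp), h.diag]
  pre j := by rw [hreal 6 (by simp), h.pre]
  total := by rw [hreal 9 (by simp), h.total]

theorem HasTables.frame {c : Cmd} (h : HasTables A s) (hf : Frame c s s')
    (hreal : ∀ a ∈ [5, 6, 9], a ∉ c.realWrites) : HasTables A s' :=
  h.congr fun a ha => hf.real a (hreal a ha)

/-- The mean of the diagonal. -/
abbrev meanExp : RealExp := .div (realVar 8) (.ofNat (natVar 0))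

/-- Compute the modified coordinate constants and their partial sums. -/
abbrev tableCmd : Cmd :=
  countLoop 3 (.const 0) (natVar 0)
    (.seq (.ite (.realLt (.get 5 (natVar 3)) meanExp) (.setReal 5 (natVar 3) meanExp) .skip)
      (.seq (.setReal 9 (.const 0) (.add (realVar 9) (.get 5 (natVar 3))))
        (.setReal 6 (natVar 3) (realVar 9))))

theorem runs_tableCmd (hsize : s.nat 0 0 = n) (hdiag : ∀ j : Fin n, s.real 5 j = A j j)
    (htr : s.real 8 0 = A.trace) (hzero : s.real 9 0 = 0) :
    Runs ω tableCmd s (HasTables A) (n * 50 + 8) := by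
  refine Runs.mono (runs_countLoop (T := 39) (l := 0) (h := n) (fun k s' =>
    (∀ j : Fin n, (j : ℕ) < k → s'.real 5 j = modDiag A j ∧ s'.real 6 j = prefixSum A (j + 1)) ∧
      (∀ j : Fin n, k ≤ (j : ℕ) → s'.real 5 j = A j j) ∧ s'.real 9 0 = prefixSum A k)
    rfl (Nat.zero_le _) (by decide) (fun s' h => ?_) ?_ ?_) ?_ ?_
  · rw [NatExp.eval, h 0 (by decide) (by decide)]
    exact hsize
  · exact ⟨fun j hj => absurd hj (Nat.not_lt_zero _), fun j _ => hdiag j,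
      hzero.trans prefixSum_zero.symm⟩
  · rintro k s' - hk h₃ hnat hreal ⟨h₁, h₂, h₄⟩
    have e₀ : s'.nat 0 0 = n := by rw [hnat 0 (by decide) (by decide), hsize]
    have e₈ : s'.real 8 0 = A.trace := by rw [hreal 8 (by decide), htr]
    have e₅ := h₂ ⟨k, hk⟩ le_rfl
    simp only at e₅
    have hsum : prefixSum A (k + 1) = prefixSum A k + modDiag A ⟨k, hk⟩ := prefixSum_succ ⟨k, hk⟩
    have hite : Runs ω (.ite (.realLt (.get 5 (natVar 3)) meanExp)
        (.setReal 5 (natVar 3) meanExp) .skip) s' (fun s₁ => s₁.real 5 k = modDiag A ⟨k, hk⟩ ∧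
          ∀ j : ℕ, j ≠ k → s₁.real 5 j = s'.real 5 j) 20 := by
      refine Runs.mono (Runs.ite (T := 9) (fun ht => ?_) fun ht => ?_) (fun _ => id)
        (by simp [Test.cost, NatExp.cost, RealExp.cost])
      · refine Runs.mono (Runs.setReal ?_) (fun _ => id) (by simp [NatExp.cost, RealExp.cost])
        simp only [Test.Holds, NatExp.eval, RealExp.eval, h₃, e₅, e₈, e₀] at ht ⊢
        exact ⟨(State.setReal_real_self ..).trans (max_eq_right ht.le).symm,
          fun j hj => State.setReal_real_of_ne_cell _ _ hj _⟩
      · refine Runs.mono (Runs.skip ?_) (fun _ => id) (by norm_num)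
        simp only [Test.Holds, NatExp.eval, RealExp.eval, h₃, e₅, e₈, e₀, not_lt] at ht
        exact ⟨e₅.trans (max_eq_left ht).symm, fun _ _ => rfl⟩
    refine Runs.mono (Runs.seq hite.frame
      fun s₁ hs₁ => Runs.setReal_seq (Runs.setReal ?_)) (fun _ => id) ?_
    · obtain ⟨⟨hself, hother⟩, hf⟩ := hs₁
      have f₃ : s₁.nat 3 0 = k := by rw [hf.nat 3 (by decide), h₃]
      have f₉ : s₁.real 9 0 = prefixSum A k := by rw [hf.real 9 (by decide), h₄]
      have f₆ : s₁.real 6 = s'.real 6 := hf.real 6 (by decide)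
      simp only [NatExp.eval, RealExp.eval, f₃, f₉, hself, State.setNat, State.setReal]
      refine ⟨fun j hj => ?_, fun j hj => ?_, ?_⟩
      · rcases eq_or_ne (j : ℕ) k with hjk | hjk
        · obtain rfl : j = ⟨k, hk⟩ := Fin.ext hjk
          simp [hself, hsum]
        · have := h₁ j (by omega)
          simp [hjk, f₆, hother j hjk, this]
      · have := h₂ j (by omega)
        simp [hother j (by omega), this]
      · simp [hsum]
    · simp [NatExp.cost, RealExp.cost]
  · rintro s' ⟨h₁, -, h₄⟩
    exact ⟨fun j => (h₁ j j.2).1, fun j => (h₁ j j.2).2, h₄.trans prefixSum_card⟩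
  · simp [NatExp.cost]

end LinSys

/-! ### The program: one iteration -/

namespace LinSys

open Matrix RAM ACDM

variable {n : ℕ} {A : Matrix (Fin n) (Fin n) ℝ} {D : SparseRep A} {b x₀ : Fin n → ℝ} {σ ε κ : ℝ}
  {ω : Coins} {s s' : State} {k : ℕ} {z : (Fin n → ℝ) × (Fin n → ℝ)}

/-- The memory holds the iterate `z = (v_k, x_k)` in the form `x_k = q + ηp`, `v_k - x_k = δp`, and
its coefficients. -/
structure HasIterate (A : Matrix (Fin n) (Fin n) ℝ) (κ : ℝ) (k : ℕ)
    (z : (Fin n → ℝ) × (Fin n → ℝ)) (s : State) : Prop where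
  coef : s.real 10 0 = coef n κ k
  decay : s.real 11 0 = decay n κ k
  scale : s.real 12 0 ≠ 0
  point : ∀ j : Fin n, s.real 4 j + s.real 13 0 * s.real 7 j = z.2 j
  diff : ∀ j : Fin n, s.real 12 0 * s.real 7 j = z.1 j - z.2 j

/-- The dimension as a real number. -/
abbrev sizeExp : RealExp := .ofNat (natVar 0)

/-- `σ / S̃`. -/
abbrev ratioExp : RealExp := .div (.get 3 (.const 0)) (realVar 9)

/-- `1 / (2n) - (σ / S̃) c²`. -/
abbrev slopeExp : RealExp :=
  .sub (.div (.const 1) (.mul (.const 2) sizeExp)) (.mul ratioExp (.mul (realVar 10) (realVar 10)))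

/-- The next coefficient `γ`. -/
abbrev nextCoefExp : RealExp :=
  .div (.add slopeExp (.sqrt (.add (.mul slopeExp slopeExp)
    (.mul (.const 4) (.mul (realVar 10) (realVar 10)))))) (.const 2)

/-- `α` in terms of `γ`. -/
abbrev mixingExp : RealExp :=
  .div (realVar 14) (.add (realVar 14)
    (.mul (.mul (.const 2) sizeExp) (.mul (realVar 10) (realVar 10))))

/-- Compute `γ`, `β`, `α`, and move from `x_k` to `y_k`. -/
abbrev coefCmd : Cmd :=
  .seq (.setReal 14 (.const 0) nextCoefExp)
    (.seq (.setReal 15 (.const 0) (.sub (.const 1) (.mul (realVar 14) ratioExp)))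
      (.seq (.setReal 16 (.const 0) mixingExp)
        (.seq (.setReal 13 (.const 0) (.add (realVar 13) (.mul (realVar 16) (realVar 12))))
          (.setReal 12 (.const 0)
            (.mul (.mul (realVar 15) (.sub (.const 1) (realVar 16))) (realVar 12))))))

theorem runs_coefCmd (hN : (1 : ℝ) ≤ n) (hκ : 0 < κ) (hκ' : κ ≤ 1) (hdata : HasData D b σ ε s)
    (hratio : s.real 3 0 / s.real 9 0 = κ) (hit : HasIterate A κ k z s) :
    Runs ω coefCmd s (fun s' => s'.real 14 0 = ACDM.coef n κ (k + 1) ∧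
      s'.real 15 0 = contraction n κ k ∧ s'.real 12 0 ≠ 0 ∧
      (∀ j : Fin n, s'.real 4 j + s'.real 13 0 * s'.real 7 j = mixPoint κ k z j) ∧
      ∀ j : Fin n, s'.real 12 0 * s'.real 7 j =
        contraction n κ k * (z.1 j - mixPoint κ k z j)) 150 := by
  refine Runs.mono (Runs.setReal_seq (Runs.setReal_seq (Runs.setReal_seq (Runs.setReal_seq
    (Runs.setReal ?_))))) (fun _ => id) (by simp [NatExp.cost, RealExp.cost])
  have hγ : nextCoefExp.eval s = ACDM.coef n κ (k + 1) := by
    simp only [NatExp.eval, RealExp.eval, hdata.size, hratio, hit.coef, ACDM.coef, nextCoef, sq]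
    norm_num
  have hγpos : 0 < ACDM.coef n κ (k + 1) := coef_pos hN _
  have hcpos : 0 < ACDM.coef n κ k := coef_pos hN _
  have hβ := contraction_pos hN hκ hκ' k
  -- The scale `δ` is multiplied by `β(1 - α)`. It must stay nonzero, since the coordinate update
  -- divides by it.
  have hα : 1 - mixing n κ k ≠ 0 := by
    have h : 1 - mixing n κ k = 2 * n * ACDM.coef n κ k ^ 2 /
        (ACDM.coef n κ (k + 1) + 2 * n * ACDM.coef n κ k ^ 2) := by
      rw [mixing]
      field_simp
      ring
    rw [h]
    positivity
  have hdef : 1 - ACDM.coef n κ (k + 1) * κ = contraction n κ k := rfl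
  have hmix : ACDM.coef n κ (k + 1) / (ACDM.coef n κ (k + 1) + 2 * n * (ACDM.coef n κ k *
    ACDM.coef n κ k)) = mixing n κ k := by rw [mixing, sq]
  rw [hγ]
  simp only [NatExp.eval, RealExp.eval, State.setReal, Function.update_self, ne_eq, Nat.reduceEqDiff, not_false_eq_true, Function.update_of_ne,
    hratio, hit.coef, hdata.size, Rat.cast_one, Rat.cast_ofNat, hdef, hmix]
  refine ⟨trivial, trivial, ?_, fun j => ?_, fun j => ?_⟩
  · exact mul_ne_zero (mul_ne_zero hβ.ne' hα) hit.scale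
  · have h₁ := hit.point j
    have h₂ := hit.diff j
    simp only [mixPoint, Pi.add_apply, Pi.smul_apply, smul_eq_mul]
    -- Here `y = x + α(v - x)`, so only `η` changes, to `η + αδ`.
    linear_combination h₁ + mixing n κ k * h₂
  · have h₂ := hit.diff j
    simp only [mixPoint, Pi.add_apply, Pi.smul_apply, smul_eq_mul]
    linear_combination contraction n κ k * (1 - mixing n κ k) * h₂

/-- Halve the interval between `nat 3 0` and `nat 6 0`. -/
abbrev bisectCmd : Cmd :=
  .seq (.setNat 7 (.const 0) (.half (.add (natVar 3) (natVar 6))))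
    (.ite (.realLt (realVar 17) (.get 6 (natVar 7))) (.setNat 6 (.const 0) (natVar 7))
      (.setNat 3 (.const 0) (.add (natVar 7) (.const 1))))

/-- Draw a coordinate and store it in `nat 3`. -/
abbrev sampleCmd : Cmd :=
  .seq (.rand 17 (.const 0))
    (.seq (.setReal 17 (.const 0) (.mul (realVar 17) (realVar 9)))
      (.seq (.setNat 3 (.const 0) (.const 0))
        (.seq (.setNat 6 (.const 0) (.sub (natVar 0) (.const 1)))
          (.loop (.natLt (natVar 3) (natVar 6)) bisectCmd))))

/-- Bisection keeps the sought coordinate between both ends. Cell `j` of the table holds the sum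
through `j`, so comparing with the middle cell decides whether the middle coordinate stays. -/
theorem runs_search (hA : A.PosDef) (hn : 0 < n) {t : ℝ} (ht : 0 ≤ t)
    (hpre : ∀ j : Fin n, s.real 6 j = prefixSum A (j + 1)) (h₁₇ : s.real 17 0 = t)
    (h₃ : s.nat 3 0 = 0) (h₆ : s.nat 6 0 = n - 1) :
    Runs ω (.loop (.natLt (natVar 3) (natVar 6)) bisectCmd) s
      (fun s' => s'.nat 3 0 = pick A hn t) ((Nat.log 2 n + 1) * 26 + 5) := by
  refine Runs.mono (Runs.loop_half (T := 21) (m := Nat.log 2 n + 1) (I := fun s' =>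
    (s'.nat 3 0 ≤ s'.nat 6 0 ∧ s'.nat 6 0 < n ∧ prefixSum A (s'.nat 3 0) ≤ t ∧
      (s'.nat 6 0 + 1 < n → t < prefixSum A (s'.nat 6 0 + 1))) ∧
      (∀ j : Fin n, s'.real 6 j = prefixSum A (j + 1)) ∧ s'.real 17 0 = t)
    (fun s' => s'.nat 6 0 - s'.nat 3 0) ?_ ?_ ?_) ?_ ?_
  · refine ⟨⟨by omega, by omega, ?_, fun h => by omega⟩, hpre, h₁₇⟩
    rwa [h₃, prefixSum_zero]
  · have := Nat.lt_pow_succ_log_self (b := 2) (by norm_num) n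
    simp only [h₃, h₆]
    omega
  · rintro s' ⟨⟨g₁, g₂, g₃, g₄⟩, g₅, g₆⟩ hb
    simp only [Test.Holds, NatExp.eval] at hb
    refine ⟨by omega, Runs.mono (Runs.setNat_seq (Runs.ite (T := 6) (fun hc => ?_) fun hc => ?_))
      (fun _ => id) (by simp [Test.cost, NatExp.cost, RealExp.cost])⟩
    all_goals
      have hmid := g₅ ⟨(s'.nat 3 0 + s'.nat 6 0) / 2, by omega⟩
      simp only at hmid
      simp only [Test.Holds, NatExp.eval, RealExp.eval, State.setNat, Function.update_self,
        g₆, hmid] at hc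
      refine Runs.mono (Runs.setNat ?_) (fun _ => id) (by simp [NatExp.cost])
      simp only [NatExp.eval, State.setNat, Function.update_self, ne_eq, Nat.reduceEqDiff,
        not_false_eq_true, Function.update_of_ne]
    · exact ⟨⟨⟨by omega, by omega, g₃, fun _ => hc⟩, g₅, g₆⟩, by omega⟩
    · exact ⟨⟨⟨by omega, g₂, not_lt.1 hc, g₄⟩, g₅, g₆⟩, by omega⟩
  · rintro s' ⟨⟨⟨g₁, g₂, g₃, g₄⟩, -, -⟩, hb⟩
    simp only [Test.Holds, NatExp.eval, not_lt] at hb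
    have he : s'.nat 3 0 = s'.nat 6 0 := le_antisymm g₁ hb
    have := (pick_eq_iff hA hn ht ⟨s'.nat 3 0, he ▸ g₂⟩).2 ⟨g₃, by simpa [he] using g₄⟩
    rw [this]
  · simp [Test.cost, NatExp.cost]

theorem runs_sampleCmd (hA : A.PosDef) (hn : 0 < n) (hsize : s.nat 0 0 = n)
    (htab : HasTables A s) (hdraws : s.draws = k) :
    Runs ω sampleCmd s (fun s' => s'.nat 3 0 = pickIndex A hn k ω ∧ s'.draws = k + 1)
      ((Nat.log 2 n + 1) * 26 + 30) := by
  have ht : 0 ≤ (ω k : ℝ) * modTrace A := mul_nonneg (ω k).2.1 (modTrace_pos hA hn).le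
  refine Runs.mono (Runs.rand_seq (Runs.setReal_seq (Runs.setNat_seq (Runs.setNat_seq
    (Runs.mono (runs_search hA hn ht ?_ ?_ ?_ ?_).frame ?_ le_rfl))))) (fun _ => id) ?_
  · exact htab.pre
  · simp [NatExp.eval, RealExp.eval, State.setReal, State.setNat, htab.total, hdraws]
  · simp [NatExp.eval, State.setNat]
  · simp [NatExp.eval, State.setNat, State.setReal, hsize]
  · rintro s' ⟨h, hf⟩
    refine ⟨h, (hf.draws rfl).trans ?_⟩
    simp [State.setNat, State.setReal, hdraws]
  · simp only [NatExp.cost, RealExp.cost]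
    omega

/-- Compute the partial derivative at `y_k` with respect to the coordinate `nat 3 0`. -/
abbrev gradCmd : Cmd :=
  .seq (.setReal 18 (.const 0) (.sub (.const 0) (.get 1 (natVar 3))))
    (rowLoop (.setReal 18 (.const 0) (.add (realVar 18) (.mul (.get 0 (natVar 4))
      (.add (.get 4 (.get 2 (natVar 4))) (.mul (realVar 13) (.get 7 (.get 2 (natVar 4)))))))))

/-- Only the entries of `y` that meet the support of row `i` are assembled from `q + ηp`, so the
cost is that of one row. -/
theorem runs_gradCmd {i : Fin n} {y : Fin n → ℝ} (hdata : HasData D b σ ε s) (hi : s.nat 3 0 = i)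
    (hy : ∀ j : Fin n, s.real 4 j + s.real 13 0 * s.real 7 j = y j) :
    Runs ω gradCmd s (fun s' => s'.real 18 0 = (A *ᵥ y) i - b i) (rowNnz A i * 40 + 21) := by
  refine Runs.mono (Runs.setReal_seq (runs_rowLoop (T := 26) (D := D) (b := b) (σ := σ) (ε := ε)
    (i := i) (fun k s' => s'.real 18 0 =
      -b i + ∑ l ∈ Finset.Ico (D.ptr i) k, D.val l * y (D.col l)) ?_ hi rfl (by decide) ?_ ?_))
    ?_ ?_
  · exact hdata.congr (fun _ _ => rfl) fun a ha => State.setReal_real_of_ne _ (by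
      revert a; decide) _ _
  · simp [State.setNat, State.setReal, RealExp.eval, NatExp.eval, hdata.rhs, hi, pad_apply]
  · intro k s' hk hk' hd h₄ h₃ hreal hI
    refine Runs.mono (Runs.setReal ?_) (fun _ => id) (by simp [NatExp.cost, RealExp.cost])
    have e₄ : s'.real 4 = s.real 4 := by
      rw [hreal 4 (by decide), State.setReal_real_of_ne _ (by decide)]
    have e₇ : s'.real 7 = s.real 7 := by
      rw [hreal 7 (by decide), State.setReal_real_of_ne _ (by decide)]
    have e₁₃ : s'.real 13 = s.real 13 := by
      rw [hreal 13 (by decide), State.setReal_real_of_ne _ (by decide)]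
    simp only [NatExp.eval, RealExp.eval, State.setReal, State.setNat, Function.update_self, hd.val,
      hd.col, h₄, e₄, e₇, e₁₃, hy, hI]
    rw [Finset.sum_Ico_succ_top hk, add_assoc]
  · intro s' hI
    rw [D.sum_row] at hI
    rw [hI]
    ring
  · simp only [NatExp.cost, RealExp.cost]
    omega

/-- Update the coordinate `nat 3 0` and the coefficients. -/
abbrev updateCmd : Cmd :=
  .seq (.setReal 18 (.const 0) (.div (realVar 18) (.get 5 (natVar 3))))
    (.seq (.setReal 19 (.const 0) (.div (.mul (.sub (realVar 14) (.const 1)) (realVar 18))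
        (realVar 12)))
      (.seq (.setReal 7 (natVar 3) (.sub (.get 7 (natVar 3)) (realVar 19)))
        (.seq (.setReal 4 (natVar 3) (.add (.sub (.get 4 (natVar 3)) (realVar 18))
            (.mul (realVar 13) (realVar 19))))
          (.seq (.setReal 11 (.const 0) (.mul (realVar 11) (realVar 15)))
            (.setReal 10 (.const 0) (realVar 14))))))

/-- The difference `v - x` changes along `e_i` by `-(γ - 1)g`, with `g` the partial derivative over
`L̃_i`. Hence `p_i` drops by `r = (γ - 1)g/δ`, and `q_i` changes by `-g + ηr` to undo the effect of
`r` on `x`. -/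
theorem runs_updateCmd {i : Fin n} (htab : HasTables A s) (hi : s.nat 3 0 = i)
    (hdecay : s.real 11 0 = ACDM.decay n κ k)
    (hγ : s.real 14 0 = ACDM.coef n κ (k + 1)) (hβ : s.real 15 0 = contraction n κ k)
    (hδ : s.real 12 0 ≠ 0)
    (hy : ∀ j : Fin n, s.real 4 j + s.real 13 0 * s.real 7 j = mixPoint κ k z j)
    (hd : ∀ j : Fin n, s.real 12 0 * s.real 7 j =
      contraction n κ k * (z.1 j - mixPoint κ k z j))
    (hg : s.real 18 0 = (A *ᵥ mixPoint κ k z) i - b i) :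
    Runs ω updateCmd s (HasIterate A κ (k + 1) (stepPair A b κ k i z)) 80 := by
  refine Runs.mono (Runs.setReal_seq (Runs.setReal_seq (Runs.setReal_seq (Runs.setReal_seq
    (Runs.setReal_seq (Runs.setReal ?_)))))) (fun _ => id) (by simp [NatExp.cost, RealExp.cost])
  simp only [NatExp.eval, RealExp.eval, State.setReal, Function.update_self, ne_eq, Nat.reduceEqDiff, not_false_eq_true, Function.update_of_ne,
    hi, htab.diag, hg, hγ, hβ, hdecay, Rat.cast_one]
  set g := ((A *ᵥ mixPoint κ k z) i - b i) / modDiag A i with hgdef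
  have hcancel : s.real 12 0 * ((ACDM.coef n κ (k + 1) - 1) * g / s.real 12 0) =
    (ACDM.coef n κ (k + 1) - 1) * g := mul_div_cancel₀ _ hδ
  set r := (ACDM.coef n κ (k + 1) - 1) * g / s.real 12 0
  have h₂ (j : Fin n) : (stepPair A b κ k i z).2 j =
      mixPoint κ k z j - g * (Pi.single i 1 : Fin n → ℝ) j := by
    simp only [stepPair, Pi.sub_apply, Pi.smul_apply, smul_eq_mul, hgdef]
    ring
  have h₁ (j : Fin n) : (stepPair A b κ k i z).1 j = contraction n κ k * z.1 j +
      (1 - contraction n κ k) * mixPoint κ k z j -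
        ACDM.coef n κ (k + 1) * g * (Pi.single i 1 : Fin n → ℝ) j := by
    simp only [stepPair, Pi.sub_apply, Pi.add_apply, Pi.smul_apply, smul_eq_mul, hgdef]
    ring
  refine ⟨by simp, ?_, ?_, fun j => ?_, fun j => ?_⟩
  · simp [ACDM.decay, Finset.prod_range_succ]
  · simpa using hδ
  · rw [h₂]
    rcases eq_or_ne j i with rfl | hj
    · simp
      linear_combination hy j
    · have hj' : (j : ℕ) ≠ i := Fin.val_ne_of_ne hj
      simp [hj, hj']
      linear_combination hy j
  · rw [h₁, h₂]
    rcases eq_or_ne j i with rfl | hj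
    · simp
      linear_combination hd j - hcancel
    · have hj' : (j : ℕ) ≠ i := Fin.val_ne_of_ne hj
      simp [hj, hj']
      linear_combination hd j

/-- One iteration of the method. -/
abbrev iterCmd : Cmd := .seq coefCmd (.seq sampleCmd (.seq gradCmd updateCmd))

/-- The state after `k` iterations. -/
structure Reached (D : SparseRep A) (b : Fin n → ℝ) (σ ε κ : ℝ) (k : ℕ)
    (z : (Fin n → ℝ) × (Fin n → ℝ)) (s : State) : Prop where
  data : HasData D b σ ε s
  tables : HasTables A s
  iterate : HasIterate A κ k z s
  draws : s.draws = k

theorem runs_iterCmd (hA : A.PosDef) (hn : 0 < n) (hκ : 0 < κ) (hκ' : κ ≤ 1)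
    (hratio : σ / modTrace A = κ) {R : ℕ} (hR : ∀ i, rowNnz A i ≤ R)
    (h : Reached D b σ ε κ k z s) :
    Runs ω iterCmd s (Reached D b σ ε κ (k + 1) (stepPair A b κ k (pickIndex A hn k ω) z))
      (R * 40 + Nat.log 2 n * 26 + 307) := by
  have hN : (1 : ℝ) ≤ n := by exact_mod_cast hn
  refine Runs.mono (Runs.seq (runs_coefCmd hN hκ hκ' h.data
    (by rw [h.data.conv, h.tables.total, hratio]) h.iterate).frame fun s₁ hs₁ => ?_)
    (fun _ => id) (T := 150 + (((Nat.log 2 n + 1) * 26 + 30) + ((R * 40 + 21) + 80))) (by omega)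
  obtain ⟨⟨hγ, hβ, hδ, hy, hd⟩, hf₁⟩ := hs₁
  have hdata₁ := h.data.frame hf₁ (by decide) (by decide)
  have htab₁ := h.tables.frame hf₁ (by decide)
  have hdraws₁ : s₁.draws = k := (hf₁.draws rfl).trans h.draws
  have hdecay₁ : s₁.real 11 0 = ACDM.decay n κ k := by
    rw [hf₁.real 11 (by decide), h.iterate.decay]
  refine Runs.seq (runs_sampleCmd hA hn hdata₁.size htab₁ hdraws₁).frame fun s₂ hs₂ => ?_
  obtain ⟨⟨hi, hdraws₂⟩, hf₂⟩ := hs₂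
  have hdata₂ : HasData D b σ ε s₂ := hdata₁.frame hf₂ (by decide) (by decide)
  have htab₂ := htab₁.frame hf₂ (by decide)
  have e₂ (a : ℕ) (ha : a ∉ sampleCmd.realWrites) : s₂.real a = s₁.real a := hf₂.real a ha
  rw [← e₂ 14 (by decide)] at hγ
  rw [← e₂ 15 (by decide)] at hβ
  rw [← e₂ 12 (by decide)] at hδ
  rw [← e₂ 11 (by decide)] at hdecay₁
  rw [← e₂ 12 (by decide), ← e₂ 7 (by decide)] at hd
  rw [← e₂ 4 (by decide), ← e₂ 13 (by decide), ← e₂ 7 (by decide)] at hy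
  refine Runs.seq (Runs.mono (runs_gradCmd hdata₂ hi hy).frame (fun _ => id)
    (Nat.add_le_add_right (Nat.mul_le_mul_right 40 (hR _)) 21)) fun s₃ hs₃ => ?_
  obtain ⟨hg, hf₃⟩ := hs₃
  have hdata₃ : HasData D b σ ε s₃ := hdata₂.frame hf₃ (by decide) (by decide)
  have htab₃ := htab₂.frame hf₃ (by decide)
  have e₃ (a : ℕ) (ha : a ∉ gradCmd.realWrites) : s₃.real a = s₂.real a := hf₃.real a ha
  rw [← e₃ 14 (by decide)] at hγ
  rw [← e₃ 15 (by decide)] at hβ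
  rw [← e₃ 12 (by decide)] at hδ
  rw [← e₃ 11 (by decide)] at hdecay₁
  rw [← e₃ 12 (by decide), ← e₃ 7 (by decide)] at hd
  rw [← e₃ 4 (by decide), ← e₃ 13 (by decide), ← e₃ 7 (by decide)] at hy
  rw [← hf₃.nat 3 (by decide)] at hi
  refine Runs.mono (runs_updateCmd htab₃ hi hdecay₁ hγ hβ hδ hy hd hg).frame (fun s₄ hs₄ => ?_)
    le_rfl
  exact ⟨hdata₃.frame hs₄.2 (by decide) (by decide), htab₃.frame hs₄.2 (by decide), hs₄.1,
    (hs₄.2.draws rfl).trans ((hf₃.draws rfl).trans hdraws₂)⟩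

end LinSys

/-! ### The whole program -/

namespace LinSys

open Matrix RAM ACDM

variable {n : ℕ} {A : Matrix (Fin n) (Fin n) ℝ} {D : SparseRep A} {b x₀ : Fin n → ℝ} {σ ε κ : ℝ}
  {ω : Coins} {s s' : State} {k : ℕ} {z : (Fin n → ℝ) × (Fin n → ℝ)}

/-- The preprocessing. -/
abbrev initCmd : Cmd :=
  .seq diagCmd (.seq tableCmd
    (.seq (.setReal 10 (.const 0) (.div (.const 1) (.mul (.const 4) sizeExp)))
      (.seq (.setReal 11 (.const 0) (.const 1)) (.setReal 12 (.const 0) (.const 1)))))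

theorem runs_initCmd (hA : A.PosDef) {R : ℕ} (hR : ∀ i, rowNnz A i ≤ R) :
    Runs ω initCmd (inputState D b x₀ σ ε) (Reached D b σ ε κ 0 (x₀, x₀))
      (n * (R * 32 + 88) + 34) := by
  have hdata : HasData D b σ ε (inputState D b x₀ σ ε) := hasData_inputState
  refine Runs.mono (Runs.seq (runs_diagCmd hA hR).frame fun s₁ hs₁ =>
    Runs.seq (T₁ := n * 50 + 8) (Runs.frame (R := HasTables A) ?_) fun s₂ hs₂ =>
      Runs.setReal_seq (Runs.setReal_seq (Runs.setReal ?_))) (fun _ => id) ?_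
  · obtain ⟨⟨h₁, h₂⟩, hf⟩ := hs₁
    exact runs_tableCmd (hdata.frame hf (by decide) (by decide)).size (fun j => (h₁ j).1) h₂
      (by rw [hf.real 9 (by decide)]; simp [inputState])
  · obtain ⟨⟨h₁, -⟩, hf₁⟩ := hs₁
    obtain ⟨htab, hf₂⟩ := hs₂
    have hd₂ := (hdata.frame hf₁ (by decide) (by decide)).frame hf₂ (by decide) (by decide)
    have e₄ (j : Fin n) : s₂.real 4 j = x₀ j := by rw [hf₂.real 4 (by decide), (h₁ j).2]
    have e₇ (j : ℕ) : s₂.real 7 j = 0 := by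
      rw [hf₂.real 7 (by decide), hf₁.real 7 (by decide)]
      simp [inputState]
    have e₁₃ : s₂.real 13 0 = 0 := by
      rw [hf₂.real 13 (by decide), hf₁.real 13 (by decide)]
      simp [inputState]
    have hdraws : s₂.draws = 0 := (hf₂.draws rfl).trans (hf₁.draws rfl)
    refine ⟨hd₂.congr (fun _ _ => rfl) fun a ha => ?_, htab.congr fun a ha => ?_, ?_, hdraws⟩
    · rw [State.setReal_real_of_ne _ (by revert a; decide),
        State.setReal_real_of_ne _ (by revert a; decide),
        State.setReal_real_of_ne _ (by revert a; decide)]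
    · rw [State.setReal_real_of_ne _ (by revert a; decide),
        State.setReal_real_of_ne _ (by revert a; decide),
        State.setReal_real_of_ne _ (by revert a; decide)]
    -- Memory that starts at zero supplies `p = 0` and `η = 0`. The scale `δ = 1` is arbitrary apart
    -- from being nonzero.
    · constructor <;>
        simp [NatExp.eval, RealExp.eval, State.setReal, hd₂.size, ACDM.coef, ACDM.decay, e₄, e₇,
          e₁₃]
  · simp only [NatExp.cost, RealExp.cost]
    rw [show R * 32 + 88 = R * 32 + 38 + 50 by ring, mul_add n (R * 32 + 38) 50]
    omega

/-- The main loop goes on as long as `4nσε²c² < 3S̃B`. -/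
abbrev goOnTest : Test :=
  .realLt (.mul (.mul (.mul (.const 4) sizeExp) (.get 3 (.const 0)))
      (.mul (.mul (.get 3 (.const 1)) (.get 3 (.const 1))) (.mul (realVar 10) (realVar 10))))
    (.mul (.mul (.const 3) (realVar 9)) (realVar 11))

/-- The test is the negated criterion multiplied by `S̃ > 0`. -/
theorem holds_goOnTest (hS : 0 < modTrace A) (hratio : σ / modTrace A = κ)
    (h : Reached D b σ ε κ k z s) : goOnTest.Holds s ↔
      ¬ 3 * ACDM.decay n κ k ≤ 4 * n * κ * ε ^ 2 * ACDM.coef n κ k ^ 2 := by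
  have hσ : σ = κ * modTrace A := by rw [← hratio, div_mul_cancel₀ _ hS.ne']
  simp only [Test.Holds, NatExp.eval, RealExp.eval, h.data.size, h.data.conv, h.data.eps,
    h.iterate.coef, h.iterate.decay, h.tables.total, Rat.cast_ofNat, not_le]
  rw [hσ, ← mul_lt_mul_iff_of_pos_left hS (b := 4 * n * κ * ε ^ 2 * ACDM.coef n κ k ^ 2)]
  ring_nf

/-- Write the current point to the output. -/
abbrev outCmd : Cmd :=
  countLoop 3 (.const 0) (natVar 0) (.setReal 4 (natVar 3)
    (.add (.get 4 (natVar 3)) (.mul (realVar 13) (.get 7 (natVar 3)))))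

theorem runs_outCmd (hsize : s.nat 0 0 = n) (hit : HasIterate A κ k z s) :
    Runs ω outCmd s (fun s' => IsOutput s' z.2) (n * 24 + 8) := by
  refine Runs.mono (runs_countLoop (T := 13) (l := 0) (h := n) (fun k s' =>
    ∀ j : Fin n, ((j : ℕ) < k → s'.real 4 j = z.2 j) ∧ (k ≤ (j : ℕ) → s'.real 4 j = s.real 4 j))
    rfl (Nat.zero_le _) (by decide) (fun s' h => ?_) ?_ ?_) (fun s' h j => (h j).1 j.2) ?_
  · rw [NatExp.eval, h 0 (by decide) (by decide)]
    exact hsize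
  · exact fun j => ⟨fun hj => absurd hj (Nat.not_lt_zero _), fun _ => rfl⟩
  · rintro k s' - hk h₃ - hreal hI
    refine Runs.mono (Runs.setReal fun j => ?_) (fun _ => id) (by simp [NatExp.cost, RealExp.cost])
    have e₇ : s'.real 7 = s.real 7 := hreal 7 (by decide)
    have e₁₃ : s'.real 13 = s.real 13 := hreal 13 (by decide)
    simp only [NatExp.eval, RealExp.eval, h₃, e₇, e₁₃, State.setNat, State.setReal,
      Function.update_self]
    rcases eq_or_ne (j : ℕ) k with hjk | hjk
    · subst hjk
      rw [Function.update_self, (hI j).2 le_rfl, hit.point j]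
      exact ⟨fun _ => rfl, fun h => by omega⟩
    · rw [Function.update_of_ne hjk]
      exact ⟨fun h => (hI j).1 (by omega), fun h => (hI j).2 (by omega)⟩
  · simp [NatExp.cost]

/-- The accelerated coordinate descent method. -/
abbrev program : Cmd := .seq initCmd (.seq (.loop goOnTest iterCmd) outCmd)

theorem runs_program (hA : A.PosDef) (hn : 0 < n) {R K : ℕ} (hR : ∀ i, rowNnz A i ≤ R)
    (hK : 3 * ACDM.decay n (ratio A b) K ≤
      4 * n * ratio A b * ε ^ 2 * ACDM.coef n (ratio A b) K ^ 2)
    (hlt : ∀ k < K, ¬ 3 * ACDM.decay n (ratio A b) k ≤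
      4 * n * ratio A b * ε ^ 2 * ACDM.coef n (ratio A b) k ^ 2) :
    Runs ω program
      (inputState D b x₀ (convexityParam (objective A b) 1) ε)
      (fun s => IsOutput s (iterPair A b (ratio A b) x₀ (fun k => pickIndex A hn k ω) K).2)
      ((K + n + 1) * (R * 40 + Nat.log 2 n * 26 + 400)) := by
  have hS := modTrace_pos hA hn
  refine Runs.mono (Runs.seq (runs_initCmd (κ := ratio A b) hA hR) fun s₁ hs₁ =>
    Runs.seq (Runs.loop (N := K) (I := fun k s => Reached D b (convexityParam (objective A b) 1) ε
      (ratio A b) k (iterPair A b (ratio A b) x₀ (fun k => pickIndex A hn k ω) k) s) (k := 0)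
      (T := R * 40 + Nat.log 2 n * 26 + 307) (Nat.zero_le _) hs₁ (fun k s hk hs => ?_)
      fun s hs => ?_) fun s₂ hs₂ => runs_outCmd hs₂.data.size hs₂.iterate) (fun _ => id) ?_
  · exact ⟨(holds_goOnTest hS rfl hs).2 (hlt k hk),
      runs_iterCmd hA hn (ratio_pos hA hn) (ratio_le_one hA hn) rfl hR hs⟩
  · rw [holds_goOnTest hS rfl hs, not_not]
    exact hK
  · simp only [Test.cost, NatExp.cost, RealExp.cost, Nat.sub_zero]
    nlinarith [Nat.zero_le (n * R), Nat.zero_le (n * Nat.log 2 n)]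

/-! ### The number of iterations and the running time. -/

theorem le_nnz (hA : A.PosDef) : n ≤ nnz A := by
  have h : Set.range (fun i : Fin n => (i, i)) ⊆ {p : Fin n × Fin n | A p.1 p.2 ≠ 0} := by
    rintro _ ⟨i, rfl⟩
    exact (diag_pos hA i).ne'
  have h₁ := Set.ncard_le_ncard h (Set.toFinite _)
  rwa [← Set.image_univ, Set.ncard_image_of_injective _ fun i j hij => (Prod.ext_iff.1 hij).1,
    Set.ncard_univ, Nat.card_eq_fintype_card, Fintype.card_fin] at h₁

theorem sq_condition (hA : A.PosDef) (hn : 0 < n) :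
    (√(numRank hA.isHermitian / n) * √(maxEig hA.isHermitian / minEig hA.isHermitian)) ^ 2 =
      A.trace / (n * minEig hA.isHermitian) := by
  have h₁ := minEig_pos hA hn
  have h₂ := maxEig_pos hA hn
  have h₃ : numRank hA.isHermitian = A.trace / maxEig hA.isHermitian := by
    rw [← numRank_mul_maxEig hA hn, mul_div_cancel_right₀ _ h₂.ne']
  have h₄ := trace_pos hA hn
  rw [mul_pow, Real.sq_sqrt (by rw [h₃]; positivity), Real.sq_sqrt (by positivity), h₃]
  field_simp

/-- The square is `tr A/(n λ_1)`, and `n λ_1 ≤ nσ ≤ tr A`. This absorbs the additive terms,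
preprocessing included, into the main bound. -/
theorem one_le_condition (hA : A.PosDef) (hn : 0 < n) :
    1 ≤ √(numRank hA.isHermitian / n) * √(maxEig hA.isHermitian / minEig hA.isHermitian) := by
  have h₁ := minEig_pos hA hn
  rw [← one_le_sq_iff₀ (by positivity), sq_condition hA hn, le_div_iff₀ (by positivity), one_mul]
  refine le_trans ?_ (mul_convexityParam_le_trace (b := 0) hA.isHermitian)
  gcongr
  exact minEig_le_convexityParam hA.isHermitian hn

/-- `K` is the first index that meets the criterion, hence exactly where the loop stops. The a
priori bound comes from `criterion_of_le`. -/
theorem exists_iteration_count (hA : A.PosDef) (hn : 0 < n) (hε : 0 < ε) (hε' : ε ≤ 1 / 2) :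
    ∃ K : ℕ, 3 * ACDM.decay n (ratio A b) K ≤
        4 * n * ratio A b * ε ^ 2 * ACDM.coef n (ratio A b) K ^ 2 ∧
      (∀ k < K, ¬ 3 * ACDM.decay n (ratio A b) k ≤
        4 * n * ratio A b * ε ^ 2 * ACDM.coef n (ratio A b) k ^ 2) ∧
      (K : ℝ) ≤ 2 + n * (√(numRank hA.isHermitian / n) *
        √(maxEig hA.isHermitian / minEig hA.isHermitian)) * (4 + 20 * Real.log (1 / ε)) := by
  classical
  set W := √(numRank hA.isHermitian / n) * √(maxEig hA.isHermitian / minEig hA.isHermitian)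
  have hN : (1 : ℝ) ≤ n := by exact_mod_cast hn
  have hκ := ratio_pos (b := b) hA hn
  have hκ' := ratio_le_one (b := b) hA hn
  have hlog : 0 ≤ Real.log (1 / ε) := Real.log_nonneg (by rw [le_div_iff₀ hε]; linarith)
  have hpos : 0 < 2 * n * ratio A b := by positivity
  set g := 1 / √(2 * n * ratio A b) with hgdef
  have hg : 0 < g := by positivity
  have hgg : 2 * n * ratio A b * g ^ 2 = 1 := by
    rw [hgdef, div_pow, Real.sq_sqrt hpos.le, one_pow, mul_one_div_cancel hpos.ne']
  set X := 4 * n * g + 1 + 2 / (ratio A b * g) * (5 * Real.log (1 / ε)) with hX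
  have hcrit := criterion_of_le hN hκ hκ' hg hgg hε hε' (k := ⌈X⌉₊) (Nat.le_ceil X)
  have hex : ∃ K : ℕ, 3 * ACDM.decay n (ratio A b) K ≤
    4 * n * ratio A b * ε ^ 2 * ACDM.coef n (ratio A b) K ^ 2 := ⟨_, hcrit⟩
  refine ⟨Nat.find hex, Nat.find_spec hex, fun k hk => Nat.find_min hex hk, ?_⟩
  have h₁ : (Nat.find hex : ℝ) ≤ ⌈X⌉₊ := by exact_mod_cast Nat.find_min' hex hcrit
  have h₂ : (⌈X⌉₊ : ℝ) ≤ X + 1 := (Nat.ceil_lt_add_one (by positivity)).le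
  -- Compare squares: `g² = S̃/(2nσ)`, with `S̃ ≤ 2 tr A` and `σ ≥ λ_1`.
  have hQ : n * g ≤ n * W := by
    have hm := minEig_pos hA hn
    refine mul_le_mul_of_nonneg_left ?_ (by positivity)
    rw [← sq_le_sq₀ hg.le (by positivity), sq_condition hA hn]
    have h₃ : g ^ 2 = modTrace A / (2 * n * convexityParam (objective A b) 1) := by
      have hσ := convexityParam_pos (b := b) hA hn
      have hS := modTrace_pos hA hn
      rw [eq_div_iff (by positivity)]
      rw [ratio] at hgg
      field_simp at hgg
      linarith
    rw [h₃, div_le_div_iff₀ (by have := convexityParam_pos (b := b) hA hn; positivity)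
      (by positivity)]
    have h₄ := minEig_le_convexityParam (b := b) hA.isHermitian hn
    have h₅ := modTrace_le hA hn
    have h₆ := trace_pos hA hn
    calc modTrace A * (n * minEig hA.isHermitian)
        ≤ (2 * A.trace) * (n * convexityParam (objective A b) 1) := by gcongr
      _ = _ := by ring
  have hκg : 2 / (ratio A b * g) = 4 * (n * g) := by
    rw [div_eq_iff (by positivity)]
    linear_combination -2 * hgg
  rw [hκg] at hX
  calc (Nat.find hex : ℝ) ≤ X + 1 := h₁.trans h₂
    _ = 2 + n * g * (4 + 20 * Real.log (1 / ε)) := by rw [hX]; ring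
    _ ≤ _ := by gcongr

theorem natLog_two_le (n : ℕ) : (Nat.log 2 n : ℝ) ≤ 2 * Real.log n := by
  have h := Real.natLog_le_logb n 2
  have h₁ : 0 ≤ Real.log n := Real.log_natCast_nonneg n
  have h₂ : 1 / 2 ≤ Real.log 2 := by linarith [Real.log_two_gt_d9]
  rw [Real.logb, Nat.cast_ofNat] at h
  refine h.trans ((div_le_iff₀ (by linarith)).2 ?_)
  nlinarith

theorem time_le {c : ℝ} (hA : A.PosDef) (hn : 0 < n) (hε : 0 < ε) (hε' : ε ≤ 1 / 2) {K R : ℕ}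
    (hR : (R : ℝ) ≤ |c| * (nnz A / n))
    (hK : (K : ℝ) ≤ 2 + n * (√(numRank hA.isHermitian / n) *
      √(maxEig hA.isHermitian / minEig hA.isHermitian)) * (4 + 20 * Real.log (1 / ε))) :
    (((K + n + 1) * (R * 40 + Nat.log 2 n * 26 + 400) : ℕ) : ℝ) ≤
      36 * (40 * |c| + 452) * nnz A * √(numRank hA.isHermitian / n) *
        √(maxEig hA.isHermitian / minEig hA.isHermitian) * Real.log (1 / ε) *
          (1 + Real.log n) ^ 1 := by
  have hW := one_le_condition hA hn
  rw [show 36 * (40 * |c| + 452) * nnz A * √(numRank hA.isHermitian / n) *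
    √(maxEig hA.isHermitian / minEig hA.isHermitian) = 36 * (40 * |c| + 452) * nnz A *
      (√(numRank hA.isHermitian / n) *
        √(maxEig hA.isHermitian / minEig hA.isHermitian)) by ring]
  set W := √(numRank hA.isHermitian / n) * √(maxEig hA.isHermitian / minEig hA.isHermitian)
  have hN : (1 : ℝ) ≤ n := by exact_mod_cast hn
  have hM : 1 ≤ (nnz A : ℝ) / n := by
    rw [le_div_iff₀ (by positivity), one_mul]
    exact_mod_cast le_nnz hA
  have hlog : 1 / 2 ≤ Real.log (1 / ε) := by
    have h₁ : Real.log 2 ≤ Real.log (1 / ε) :=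
      Real.log_le_log two_pos (by rw [le_div_iff₀ hε]; linarith)
    linarith [Real.log_two_gt_d9]
  have hL := natLog_two_le n
  have hlogn : 0 ≤ Real.log n := Real.log_natCast_nonneg n
  set ℓ := Real.log (1 / ε)
  have hNW : (n : ℝ) ≤ n * W := le_mul_of_one_le_right (by positivity) hW
  -- All terms free of `ℓ` sum to at most `8nW ≤ 16nWℓ`, as `ℓ ≥ 1/2`; the remaining term is
  -- `20nWℓ`.
  have h₁ : ((K : ℝ) + n + 1) ≤ 36 * (n * W * ℓ) := by
    have h₂ : n * W ≤ 2 * (n * W * ℓ) := by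
      nlinarith [mul_le_mul_of_nonneg_left hlog (show 0 ≤ n * W by positivity)]
    nlinarith
  have h₂ : (R : ℝ) * 40 + Nat.log 2 n * 26 + 400 ≤
      nnz A / n * (40 * |c| + 452) * (1 + Real.log n) := by
    set M := (nnz A : ℝ) / n
    have h₃ : (R : ℝ) * 40 ≤ M * (40 * |c|) * (1 + Real.log n) := by
      calc (R : ℝ) * 40 ≤ (|c| * M) * 40 := by gcongr
        _ = M * (40 * |c|) * 1 := by ring
        _ ≤ _ := by gcongr; linarith
    -- The constant is `452 = 400 + 2 · 26`, and `nnz A / n ≥ 1` lets the logarithmic cost be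
    -- charged to the row cost.
    have h₄ : (Nat.log 2 n : ℝ) * 26 + 400 ≤ M * (452 * (1 + Real.log n)) := by
      calc (Nat.log 2 n : ℝ) * 26 + 400 ≤ 1 * (452 * (1 + Real.log n)) := by linarith
        _ ≤ _ := by gcongr
    linarith
  push_cast
  calc ((K : ℝ) + n + 1) * (R * 40 + Nat.log 2 n * 26 + 400)
      ≤ 36 * (n * W * ℓ) * (nnz A / n * (40 * |c| + 452) * (1 + Real.log n)) := by gcongr
    _ = _ := by field_simp

end LinSys

theorem mainTheorem4 :
    ∃ (P : RAM.Cmd) (p : ℕ), ∀ c : ℝ, ∃ C : ℝ,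
      ∀ (n : ℕ), 0 < n →
      ∀ (A : Matrix (Fin n) (Fin n) ℝ) (hA : A.PosDef),
      (∀ i, (LinSys.rowNnz A i : ℝ) ≤ c * ((LinSys.nnz A : ℝ) / n)) →
      ∀ (D : LinSys.SparseRep A) (b x₀ xs : Fin n → ℝ), A.mulVec xs = b →
      ∀ ε : ℝ, 0 < ε → ε ≤ 1 / 2 →
      ∃ (K : ℕ) (idx : ℕ → RAM.Coins → Fin n) (T : RAM.Coins → ACDM.Trace n),
        -- the picked coordinates are independent with the distribution of the method
        ((∀ k, Measurable (idx k)) ∧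
          ProbabilityTheory.iIndepFun idx RAM.coinMeasure ∧
          ∀ k i, RAM.coinMeasure.real {ω | idx k ω = i} =
            ACDM.sampleProb (LinSys.objective A b) 1 i) ∧
        (∀ ω, ACDM.IsRun (LinSys.objective A b) 1 x₀ (fun k => idx k ω) (T ω)) ∧
        -- the program outputs the iterate `x_K` within the claimed time
        (∀ ω, ∃ (s : RAM.State) (t : ℕ),
          RAM.Exec ω P
            (LinSys.inputState D b x₀ (ACDM.convexityParam (LinSys.objective A b) 1) ε) s t ∧
          LinSys.IsOutput s ((T ω).x K) ∧
          (t : ℝ) ≤ C * (LinSys.nnz A : ℝ) * Real.sqrt (LinSys.numRank hA.isHermitian / n) *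
            Real.sqrt (LinSys.maxEig hA.isHermitian / LinSys.minEig hA.isHermitian) *
            Real.log (1 / ε) * (1 + Real.log n) ^ p) ∧
        -- the expected error in the norm of `A` is at most `ε` times the initial one
        MeasureTheory.Integrable
          (fun ω => LinSys.energyNorm A ((T ω).x K - xs)) RAM.coinMeasure ∧
        ∫ ω, LinSys.energyNorm A ((T ω).x K - xs) ∂(RAM.coinMeasure) ≤
          ε * LinSys.energyNorm A (x₀ - xs) := by
  -- The absolute value keeps the constant positive for every real `c`.
  refine ⟨LinSys.program, 1, fun c => ⟨36 * (40 * |c| + 452), ?_⟩⟩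
  intro n hn A hA hrow D b x₀ xs hxs ε hε hε'
  obtain ⟨K, hK, hlt, hKle⟩ := LinSys.exists_iteration_count (b := b) hA hn hε hε'
  refine ⟨K, LinSys.pickIndex A hn,
    fun ω => LinSys.runTrace A b x₀ fun k => LinSys.pickIndex A hn k ω,
    ⟨LinSys.measurable_pickIndex hA hn, LinSys.iIndepFun_pickIndex hA hn, fun k i => ?_⟩,
    fun ω => LinSys.isRun_runTrace hA hn x₀ _, fun ω => ?_, ?_, ?_⟩
  · rw [LinSys.sampleProb_objective hA, LinSys.coinMeasure_pickIndex_eq hA hn]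
  · have hR (i : Fin n) : LinSys.rowNnz A i ≤ ⌊|c| * ((LinSys.nnz A : ℝ) / n)⌋₊ :=
      Nat.le_floor ((hrow i).trans (by gcongr; exact le_abs_self c))
    obtain ⟨s, t, hexec, hout, ht⟩ :=
      LinSys.runs_program (D := D) (x₀ := x₀) (ω := ω) hA hn hR hK hlt
    exact ⟨s, t, hexec, hout, le_trans (by exact_mod_cast ht)
      (LinSys.time_le hA hn hε hε' (Nat.floor_le (by positivity)) hKle)⟩
  · exact LinSys.integrable_iterPair hn (LinSys.measurable_pickIndex hA hn)
      (fun z => LinSys.energyNorm A (z.2 - xs)) K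
  · exact LinSys.integral_energyNorm_le hA hn (LinSys.measurable_pickIndex hA hn)
      (LinSys.iIndepFun_pickIndex hA hn) (LinSys.coinMeasure_pickIndex_eq hA hn) hxs hε hK
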